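/- **Proposition.** Let $(M,g)$ be an oriented smooth Riemannian 4-manifold with Levi-Civita connection $\nabla$, and let $W^+$ be the self-dual half of its Weyl tensor, i.e. the $\Lambda^+$–$\Lambda^+$ block of the Weyl tensor. If $g$ is Einstein, that is $\mathrm{Ric}=\Lambda g$ with a constant $\Lambda\in\mathbb R$, then $W^+$ is divergence-free: $$(\nabla\cdot W^+)_{\nu\rho\sigma}=\nabla^\mu W^+_{\mu\nu\rho\sigma}=0 .$$ In Plebański language this is the equation $d^A(\Psi^{ij}\Sigma^j)=0$, in the following sense. Let $V$ be an open subset of a positively oriented coordinate domain of $M$, and let $(\Sigma^1,\Sigma^2,\Sigma^3)$ be a smooth frame of self-dual 2-forms on $V$ satisfying the quaternion algebra $$\Sigma^i{}_\mu{}^\alpha\,\Sigma^j{}_\alpha{}^\nu=-\delta^{ij}\delta_\mu^\nu+\epsilon^{ijk}\,\Sigma^k{}_\mu{}^\nu .$$ For triples of 1-forms $A^i$ and of 2-forms $B^i$ write $(d^AB)^i=dB^i+\epsilon^{ijk}A^j\wedge B^k$. Then on $V$ there are smooth 1-forms $A^i$ with $d^A\Sigma^i=0$ and a smooth symmetric traceless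 matrix function $\Psi^{ij}$ with $W^+_{\mu\nu\rho\sigma}=\Psi^{ij}\Sigma^i_{\mu\nu}\Sigma^j_{\rho\sigma}$. For all such $A$ and $\Psi$, and whether or not $g$ is Einstein, $$\nabla\cdot W^+=0 \ \text{ on } V\quad\Longleftrightarrow\quad d^A(\Psi^{ij}\Sigma^j)=0\ \text{ on } V .$$ In particular, if $g$ is Einstein, then $d^A(\Psi^{ij}\Sigma^j)=0$ on $V$. -/

import Mathlib

open scoped Manifold ContDiff

noncomputable section

namespace Plebanski

/-- The model space of a four-manifold. -/
abbrev E4 : Type := EuclideanSpace ℝ (Fin 4)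

/-! ### Tensor calculus in a coordinate domain of `ℝ⁴`

Tensor fields are given by their coordinate components, all indices down unless stated otherwise.
A metric is a field of matrices `G`, with `G x μ ν = g_{μν}(x)`. -/

/-- The partial derivative `∂_μ f` at `x`. -/
def pd (μ : Fin 4) (f : E4 → ℝ) (x : E4) : ℝ :=
  fderiv ℝ f x (EuclideanSpace.single μ 1)

/-- The Levi-Civita symbol: the sign of `s` if `s` is a permutation, and `0` otherwise. -/
def eps {n : ℕ} (s : Fin n → Fin n) : ℝ :=
  ((1 : Matrix (Fin n) (Fin n) ℝ).submatrix s id).det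

/-- The Christoffel symbol `Γ^ρ_{μν}` of the Levi-Civita connection of `G`. -/
def christoffel (G : E4 → Matrix (Fin 4) (Fin 4) ℝ) (x : E4) (ρ μ ν : Fin 4) : ℝ :=
  (1 / 2) * ∑ σ, (G x)⁻¹ ρ σ *
    (pd μ (fun y => G y σ ν) x + pd ν (fun y => G y σ μ) x - pd σ (fun y => G y μ ν) x)

/-- The curvature tensor `R^ρ_{σμν}` (first index up). -/
def riemannUp (G : E4 → Matrix (Fin 4) (Fin 4) ℝ) (x : E4) (ρ σ μ ν : Fin 4) : ℝ :=
  pd μ (fun y => christoffel G y ρ ν σ) x - pd ν (fun y => christoffel G y ρ μ σ) x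
    + ∑ l, (christoffel G x ρ μ l * christoffel G x l ν σ
      - christoffel G x ρ ν l * christoffel G x l μ σ)

/-- The curvature tensor `R_{ρσμν}`. -/
def riemann (G : E4 → Matrix (Fin 4) (Fin 4) ℝ) (x : E4) (ρ σ μ ν : Fin 4) : ℝ :=
  ∑ l, G x ρ l * riemannUp G x l σ μ ν

/-- The Ricci tensor `R_{σν} = R^ρ_{σρν}`. -/
def ricci (G : E4 → Matrix (Fin 4) (Fin 4) ℝ) (x : E4) (σ ν : Fin 4) : ℝ :=
  ∑ ρ, riemannUp G x ρ σ ρ ν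

/-- The scalar curvature. -/
def scalarCurv (G : E4 → Matrix (Fin 4) (Fin 4) ℝ) (x : E4) : ℝ :=
  ∑ σ, ∑ ν, (G x)⁻¹ σ ν * ricci G x σ ν

/-- The Weyl tensor `W_{ρσμν}` in dimension four. -/
def weyl (G : E4 → Matrix (Fin 4) (Fin 4) ℝ) (x : E4) (ρ σ μ ν : Fin 4) : ℝ :=
  riemann G x ρ σ μ ν
    - (1 / 2) * (G x ρ μ * ricci G x σ ν - G x ρ ν * ricci G x σ μ
      + G x σ ν * ricci G x ρ μ - G x σ μ * ricci G x ρ ν)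
    + (scalarCurv G x / 6) * (G x ρ μ * G x σ ν - G x ρ ν * G x σ μ)

/-- The Hodge star of the metric matrix `g` on (components of) 2-forms, for the orientation given
by the coordinates: `(⋆B)_{μν} = ½ √(det g) ε_{μναβ} B^{αβ}`. -/
def hodge (g : Matrix (Fin 4) (Fin 4) ℝ) (B : Fin 4 → Fin 4 → ℝ) (μ ν : Fin 4) : ℝ :=
  (1 / 2) * ∑ α, ∑ β, Real.sqrt g.det * eps ![μ, ν, α, β] *
    ∑ κ, ∑ l, g⁻¹ α κ * g⁻¹ β l * B κ l

/-- The projection `½(1 + ⋆)` onto self-dual 2-forms. -/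
def sdProj (g : Matrix (Fin 4) (Fin 4) ℝ) (B : Fin 4 → Fin 4 → ℝ) (μ ν : Fin 4) : ℝ :=
  (1 / 2) * (B μ ν + hodge g B μ ν)

/-- The self-dual half `W⁺_{μνρσ}` of the Weyl tensor: the `Λ⁺`-`Λ⁺` block of the Weyl tensor,
i.e. its self-dual projection in each of the two index pairs. -/
def sdWeyl (G : E4 → Matrix (Fin 4) (Fin 4) ℝ) (x : E4) (μ ν ρ σ : Fin 4) : ℝ :=
  sdProj (G x) (fun α β => sdProj (G x) (fun κ l => weyl G x α β κ l) ρ σ) μ ν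

/-- The Levi-Civita covariant derivative `∇_l T_{μνρσ}` of a covariant 4-tensor field. -/
def covDeriv (G : E4 → Matrix (Fin 4) (Fin 4) ℝ)
    (T : E4 → Fin 4 → Fin 4 → Fin 4 → Fin 4 → ℝ) (x : E4) (l μ ν ρ σ : Fin 4) : ℝ :=
  pd l (fun y => T y μ ν ρ σ) x
    - ∑ κ, (christoffel G x κ l μ * T x κ ν ρ σ + christoffel G x κ l ν * T x μ κ ρ σ
      + christoffel G x κ l ρ * T x μ ν κ σ + christoffel G x κ l σ * T x μ ν ρ κ)

/-- The divergence `(∇ · T)_{νρσ} = ∇^μ T_{μνρσ}`. -/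
def divergence (G : E4 → Matrix (Fin 4) (Fin 4) ℝ)
    (T : E4 → Fin 4 → Fin 4 → Fin 4 → Fin 4 → ℝ) (x : E4) (ν ρ σ : Fin 4) : ℝ :=
  ∑ μ, ∑ l, (G x)⁻¹ μ l * covDeriv G T x l μ ν ρ σ

/-- The divergence of the self-dual Weyl tensor. -/
def divSDWeyl (G : E4 → Matrix (Fin 4) (Fin 4) ℝ) (x : E4) (ν ρ σ : Fin 4) : ℝ :=
  divergence G (sdWeyl G) x ν ρ σ

/-! ### The chiral formalism -/

/-- The exterior derivative of a 2-form:
`(dB)_{lμν} = ∂_l B_{μν} + ∂_μ B_{νl} + ∂_ν B_{lμ}`. -/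
def extd (B : E4 → Matrix (Fin 4) (Fin 4) ℝ) (x : E4) (l μ ν : Fin 4) : ℝ :=
  pd l (fun y => B y μ ν) x + pd μ (fun y => B y ν l) x + pd ν (fun y => B y l μ) x

/-- The wedge product of a 1-form and a 2-form. -/
def wedge (a : Fin 4 → ℝ) (B : Matrix (Fin 4) (Fin 4) ℝ) (l μ ν : Fin 4) : ℝ :=
  a l * B μ ν + a μ * B ν l + a ν * B l μ

/-- The exterior covariant derivative of a triple of 2-forms,
`(d^A B)^i = dB^i + ε^{ijk} A^j ∧ B^k`. -/
def extdCov (A : Fin 3 → E4 → Fin 4 → ℝ) (B : Fin 3 → E4 → Matrix (Fin 4) (Fin 4) ℝ)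
    (i : Fin 3) (x : E4) (l μ ν : Fin 4) : ℝ :=
  extd (B i) x l μ ν + ∑ j, ∑ k, eps ![i, j, k] * wedge (A j x) (B k x) l μ ν

/-- `S = (Σ¹, Σ², Σ³)` is a smooth frame of the bundle of self-dual 2-forms over the coordinate
domain `V`, normalised by the quaternion algebra
`Σ^i_μ^α Σ^j_α^ν = -δ^{ij} δ_μ^ν + ε^{ijk} Σ^k_μ^ν`. -/
structure IsSDFrame (G : E4 → Matrix (Fin 4) (Fin 4) ℝ) (V : Set E4)
    (S : Fin 3 → E4 → Matrix (Fin 4) (Fin 4) ℝ) : Prop where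
  smooth : ∀ i μ ν, ContDiffOn ℝ ∞ (fun y => S i y μ ν) V
  antisymm : ∀ i, ∀ x ∈ V, ∀ μ ν, S i x ν μ = - S i x μ ν
  selfDual : ∀ i, ∀ x ∈ V, ∀ μ ν, hodge (G x) (S i x) μ ν = S i x μ ν
  quaternion : ∀ i j, ∀ x ∈ V,
    (S i x * (G x)⁻¹) * (S j x * (G x)⁻¹) =
      (if i = j then (-1 : Matrix (Fin 4) (Fin 4) ℝ) else 0)
        + ∑ k, eps ![i, j, k] • (S k x * (G x)⁻¹)

/-- `A` is the self-dual connection of the frame `S`: smooth 1-forms with `d^A Σ^i = 0`. -/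
structure IsSDConnection (V : Set E4) (S : Fin 3 → E4 → Matrix (Fin 4) (Fin 4) ℝ)
    (A : Fin 3 → E4 → Fin 4 → ℝ) : Prop where
  smooth : ∀ i μ, ContDiffOn ℝ ∞ (fun y => A i y μ) V
  compatible : ∀ i, ∀ x ∈ V, ∀ l μ ν, extdCov A S i x l μ ν = 0

/-- `Ψ` is the matrix of the self-dual Weyl curvature in the frame `S`: it is symmetric and
traceless and `W⁺_{μνρσ} = Ψ^{ij} Σ^i_{μν} Σ^j_{ρσ}`. -/
structure IsWeylMatrix (G : E4 → Matrix (Fin 4) (Fin 4) ℝ) (V : Set E4)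
    (S : Fin 3 → E4 → Matrix (Fin 4) (Fin 4) ℝ)
    (Ψ : E4 → Matrix (Fin 3) (Fin 3) ℝ) : Prop where
  smooth : ∀ i j, ContDiffOn ℝ ∞ (fun y => Ψ y i j) V
  symm : ∀ x ∈ V, (Ψ x).IsSymm
  traceless : ∀ x ∈ V, (Ψ x).trace = 0
  weyl_eq : ∀ x ∈ V, ∀ μ ν ρ σ,
    sdWeyl G x μ ν ρ σ = ∑ i, ∑ j, Ψ x i j * S i x μ ν * S j x ρ σ

/-- The triple of 2-forms `Ψ^{ij} Σ^j`. -/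
def psiSigma (Ψ : E4 → Matrix (Fin 3) (Fin 3) ℝ)
    (S : Fin 3 → E4 → Matrix (Fin 4) (Fin 4) ℝ) (i : Fin 3) (x : E4) :
    Matrix (Fin 4) (Fin 4) ℝ :=
  ∑ j, Ψ x i j • S j x

/-! ### Riemannian four-manifolds -/

section Manifold

variable {M : Type*} [TopologicalSpace M] [ChartedSpace E4 M] [IsManifold 𝓘(ℝ, E4) ∞ M]

/-- Smooth Riemannian metrics on a four-manifold. -/
abbrev RiemMetric (M : Type*) [TopologicalSpace M] [ChartedSpace E4 M]
    [IsManifold 𝓘(ℝ, E4) ∞ M] :=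
  Bundle.ContMDiffRiemannianMetric 𝓘(ℝ, E4) ∞ E4 (fun x : M => TangentSpace 𝓘(ℝ, E4) x)

/-- The components `g_{μν} = g(∂_μ, ∂_ν)` of a metric in the chart `φ`, as functions of the
coordinates. -/
def chartMetric (g : RiemMetric M) (φ : OpenPartialHomeomorph M E4) (y : E4) :
    Matrix (Fin 4) (Fin 4) ℝ :=
  Matrix.of fun μ ν => g.inner (φ.symm y)
    (mfderiv 𝓘(ℝ, E4) 𝓘(ℝ, E4) φ.symm y (EuclideanSpace.single μ (1 : ℝ) : E4))
    (mfderiv 𝓘(ℝ, E4) 𝓘(ℝ, E4) φ.symm y (EuclideanSpace.single ν (1 : ℝ) : E4))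

/-- The metric is Einstein: `Ric = Λ g` for a constant `Λ`. -/
def IsEinstein (g : RiemMetric M) : Prop :=
  ∃ Λ : ℝ, ∀ φ ∈ IsManifold.maximalAtlas 𝓘(ℝ, E4) ∞ M, ∀ y ∈ φ.target, ∀ μ ν,
    ricci (chartMetric g φ) y μ ν = Λ * chartMetric g φ y μ ν

/-- An orientation of a four-manifold, given by an oriented atlas: smooth charts which cover the
manifold and whose changes of coordinates have positive Jacobian determinant. -/
structure OrientedAtlas (M : Type*) [TopologicalSpace M] [ChartedSpace E4 M] where
  /-- The positively oriented charts. -/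
  charts : Set (OpenPartialHomeomorph M E4)
  smooth : charts ⊆ IsManifold.maximalAtlas 𝓘(ℝ, E4) ∞ M
  cover : ∀ p : M, ∃ φ ∈ charts, p ∈ φ.source
  det_pos : ∀ φ ∈ charts, ∀ ψ ∈ charts, ∀ y ∈ (φ.symm.trans ψ).source,
    0 < (fderiv ℝ (φ.symm.trans ψ) y).det

/-- The self-dual Weyl curvature of an oriented Riemannian four-manifold is divergence-free,
`∇ · W⁺ = 0`. -/
def DivFreeSDWeyl (g : RiemMetric M) (o : OrientedAtlas M) : Prop :=
  ∀ φ ∈ o.charts, ∀ y ∈ φ.target, ∀ ν ρ σ, divSDWeyl (chartMetric g φ) y ν ρ σ = 0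

end Manifold

end Plebanski

end

namespace Plebanski

open Matrix

noncomputable section

/-! ### The Levi-Civita symbol and the duality of antisymmetric matrices -/

/-! Everything is computed in a positively oriented chart, with 2-forms as antisymmetric 4×4
matrices. The algebra of the Hodge star is reduced to polynomial identities for the metric-free
contraction `dual`: its behaviour under a change of basis, the infinitesimal version of that, and a
Clifford relation. The first gives ⋆⋆ = 1 on 2-forms; the second, together with ∂√det g = (tr Γ)√det
g, shows that ⋆ is parallel (`covD_hodgeStar`).

The bridge between divergences and exterior derivatives is `sum_inv_mul_hodgeStar_eq_zero_iff`: for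
a 1-form C with values in 2-forms, the divergence of ⋆C vanishes exactly when the cyclic sum of C
does. If C is self-dual, this equates a divergence with an exterior derivative.

Einstein metrics. Since W is trace-free, the stars on its two index pairs agree, so W⁺ = ½(W + ⋆W)
(`sdWeyl_eq`). Under Ric = Λg the tensor W differs from the Riemann tensor by a constant multiple of
a parallel tensor, so W satisfies the second Bianchi identity. Contracting that identity gives ∇·W =
0, because all traces of ∇W vanish; read as a cyclic sum it gives ∇·⋆W = 0 by the bridge.

Plebański form. The derivative ∇Σ^i is again self-dual, and the pairings of the Σ^i are constant.
Hence ∇Σ^i = -ε^{ijk} A^j Σ^k for an explicit A (`covD_eq`), and the quaternion algebra makes A the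
only solution of d^A Σ = 0 (`eq_sdConn`). By the Leibniz rule ∇_l W⁺ = (D_lΨ)^{ij} Σ^i Σ^j, with D
acting on Ψ through A. Put C^j_l = (D_lΨ)^{ij} Σ^i. Then ∇·W⁺ is the combination of the Σ^j whose
coefficients are the divergences of C^j, while d^A(ΨΣ)^j is the cyclic sum of C^j. Each C^j_l is
self-dual and the Σ^j are independent, so the bridge gives the equivalence
(`divSDWeyl_eq_zero_iff`). -/

/-- Real `4 × 4` matrices. -/
abbrev Mat4 : Type := Matrix (Fin 4) (Fin 4) ℝ

/-- Selecting rows of the Vandermonde matrix with nodes 0, …, n-1 gives the Vandermonde matrix of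
the selected nodes. Dividing by the nonzero determinant turns the symbol into an explicit polynomial
in its indices; for n = 3 and n = 4 the divisors are 2 and 12. -/
theorem eps_mul_det_vandermonde {n : ℕ} (s : Fin n → Fin n) :
    eps s * (vandermonde fun i : Fin n => ((i : ℕ) : ℝ)).det
      = (vandermonde fun i : Fin n => ((s i : ℕ) : ℝ)).det := by
  rw [eps, ← det_mul]
  congr 1
  ext i j
  simp [Matrix.mul_apply, Matrix.one_apply, vandermonde_apply]

theorem eps_three (a b c : Fin 3) :
    eps ![a, b, c] = (((b : ℕ) : ℝ) - (a : ℕ)) * ((c : ℕ) - (a : ℕ)) * ((c : ℕ) - (b : ℕ)) / 2 := by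
  have h := eps_mul_det_vandermonde ![a, b, c]
  have h2 : ∀ i : Fin 3, Finset.Ioi i = Finset.univ.filter (fun j => i < j) := by decide
  simp only [det_vandermonde, h2, Finset.prod_filter, Fin.prod_univ_three] at h
  norm_num [Fin.lt_def] at h
  rw [eq_div_iff two_ne_zero, h]
  rfl

theorem eps_four (a b c d : Fin 4) :
    eps ![a, b, c, d] = (((b : ℕ) : ℝ) - (a : ℕ)) * ((c : ℕ) - (a : ℕ)) * ((d : ℕ) - (a : ℕ))
      * ((c : ℕ) - (b : ℕ)) * ((d : ℕ) - (b : ℕ)) * ((d : ℕ) - (c : ℕ)) / 12 := by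
  have h := eps_mul_det_vandermonde ![a, b, c, d]
  have h2 : ∀ i : Fin 4, Finset.Ioi i = Finset.univ.filter (fun j => i < j) := by decide
  simp only [det_vandermonde, h2, Finset.prod_filter, Fin.prod_univ_four] at h
  norm_num [Fin.lt_def] at h
  rw [eq_div_iff (by norm_num), h]
  simp only [Matrix.cons_val]
  ring

/-- The contraction `½ ε_{μναβ} X_{αβ}` of a matrix with the Levi-Civita symbol. -/
def dual (X : Mat4) : Mat4 :=
  Matrix.of fun μ ν => (1 / 2) * ∑ α, ∑ β, eps ![μ, ν, α, β] * X α β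

theorem dual_eq (X : Mat4) : dual X = (1 / 2 : ℝ) •
    !![0, X 2 3 - X 3 2, X 3 1 - X 1 3, X 1 2 - X 2 1;
      X 3 2 - X 2 3, 0, X 0 3 - X 3 0, X 2 0 - X 0 2;
      X 1 3 - X 3 1, X 3 0 - X 0 3, 0, X 0 1 - X 1 0;
      X 2 1 - X 1 2, X 0 2 - X 2 0, X 1 0 - X 0 1, 0] := by
  ext μ ν
  fin_cases μ <;> fin_cases ν <;>
    simp [dual, Fin.sum_univ_four, eps_four] <;> norm_num <;> ring

theorem hodge_eq (g : Mat4) (B : Mat4) :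
    hodge g B = √g.det • dual (g⁻¹ * B * g⁻¹ᵀ) := by
  ext μ ν
  simp only [hodge, dual, Matrix.smul_apply, Matrix.of_apply, smul_eq_mul, Finset.mul_sum]
  refine Finset.sum_congr rfl fun α _ => Finset.sum_congr rfl fun β _ => ?_
  have : ((g⁻¹ * B * g⁻¹ᵀ) α β) = ∑ κ, ∑ l, g⁻¹ α κ * g⁻¹ β l * B κ l := by
    simp only [Matrix.mul_apply, Matrix.transpose_apply, Finset.sum_mul]
    rw [Finset.sum_comm]
    exact Finset.sum_congr rfl fun _ _ => Finset.sum_congr rfl fun _ _ => by ring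
  rw [this]
  simp only [Finset.mul_sum]
  exact Finset.sum_congr rfl fun _ _ => Finset.sum_congr rfl fun _ _ => by ring

/-- Every antisymmetric `4 × 4` matrix is given by its six upper entries. -/
theorem eq_of_antisymm {X : Mat4} (h : Xᵀ = -X) :
    X = !![0, X 0 1, X 0 2, X 0 3; -X 0 1, 0, X 1 2, X 1 3; -X 0 2, -X 1 2, 0, X 2 3;
      -X 0 3, -X 1 3, -X 2 3, 0] := by
  have h' : ∀ i j, X j i = -X i j := fun i j => congrFun (congrFun h i) j
  have hd : ∀ i, X i i = 0 := fun i => by linarith [h' i i]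
  ext i j
  fin_cases i <;> fin_cases j <;> simp [hd] <;> exact h' _ _

theorem dual_antisymm (X : Mat4) : (dual X)ᵀ = -dual X := by
  rw [dual_eq]
  ext i j
  fin_cases i <;> fin_cases j <;> simp <;> ring

theorem dual_add (X Y : Mat4) : dual (X + Y) = dual X + dual Y := by
  ext; simp [dual, mul_add, Finset.sum_add_distrib]

theorem dual_smul (c : ℝ) (X : Mat4) : dual (c • X) = c • dual X := by
  ext; simp [dual, Finset.mul_sum, mul_left_comm]

theorem dual_neg (X : Mat4) : dual (-X) = -dual X := by
  ext; simp [dual]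

theorem dual_dual {X : Mat4} (h : Xᵀ = -X) : dual (dual X) = X := by
  rw [dual_eq, dual_eq]
  conv_rhs => rw [eq_of_antisymm h]
  have h' : ∀ i j, X j i = -X i j := fun i j => congrFun (congrFun h i) j
  ext i j
  fin_cases i <;> fin_cases j <;>
    simp [h' 0 1, h' 0 2, h' 0 3, h' 1 2, h' 1 3, h' 2 3] <;> ring

/-- Two antisymmetric matrices are equal if their upper entries agree. -/
theorem ext_antisymm {X Y : Mat4} (hX : Xᵀ = -X) (hY : Yᵀ = -Y) (h : ∀ i j, i < j → X i j = Y i j) :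
    X = Y := by
  rw [eq_of_antisymm hX, eq_of_antisymm hY, h 0 1 (by decide), h 0 2 (by decide),
    h 0 3 (by decide), h 1 2 (by decide), h 1 3 (by decide), h 2 3 (by decide)]

set_option maxHeartbeats 4000000 in
/-- The transformation of the dual under a change of basis. -/
theorem transpose_mul_dual_mul (A : Mat4) {X : Mat4} (h : Xᵀ = -X) :
    Aᵀ * dual (A * X * Aᵀ) * A = A.det • dual X := by
  refine ext_antisymm
    (by rw [transpose_mul, transpose_mul, dual_antisymm, transpose_transpose, neg_mul, mul_neg,
      ← Matrix.mul_assoc])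
    (by rw [transpose_smul, dual_antisymm, smul_neg]) ?_
  rw [dual_eq, dual_eq, eq_of_antisymm h]
  generalize X 0 1 = x01, X 0 2 = x02, X 0 3 = x03, X 1 2 = x12, X 1 3 = x13, X 2 3 = x23
  intro i j hij
  rw [det_succ_row_zero]
  fin_cases i <;> fin_cases j <;> first | exact absurd hij (by decide) | skip
  all_goals
    simp [Matrix.mul_apply, Fin.sum_univ_four, det_fin_three, Fin.succAbove]
    ring

set_option maxHeartbeats 4000000 in
/-- The infinitesimal form of `transpose_mul_dual_mul`. -/
theorem dual_mul_add_mul_transpose (A : Mat4) {X : Mat4} (h : Xᵀ = -X) :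
    dual (A * X + X * Aᵀ) = A.trace • dual X - Aᵀ * dual X - dual X * A := by
  refine ext_antisymm (dual_antisymm _)
    (by simp only [transpose_sub, transpose_smul, transpose_mul, dual_antisymm, transpose_transpose,
      neg_mul, mul_neg, smul_neg]; abel) ?_
  rw [dual_eq, dual_eq, eq_of_antisymm h]
  generalize X 0 1 = x01, X 0 2 = x02, X 0 3 = x03, X 1 2 = x12, X 1 3 = x13, X 2 3 = x23
  intro i j hij
  fin_cases i <;> fin_cases j <;> first | exact absurd hij (by decide) | skip
  all_goals
    simp [Matrix.mul_apply, Fin.sum_univ_four, Matrix.vecMul, dotProduct, Matrix.trace]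
    ring

set_option maxHeartbeats 4000000 in
/-- The Clifford relation of antisymmetric matrices and their duals. -/
theorem mul_dual_add_mul_dual {X Y : Mat4} (hX : Xᵀ = -X) (hY : Yᵀ = -Y) :
    X * dual Y + Y * dual X = (2⁻¹ * (X * dual Y).trace) • (1 : Mat4) := by
  rw [dual_eq, dual_eq, eq_of_antisymm hX, eq_of_antisymm hY]
  generalize X 0 1 = x01, X 0 2 = x02, X 0 3 = x03, X 1 2 = x12, X 1 3 = x13, X 2 3 = x23
  generalize Y 0 1 = y01, Y 0 2 = y02, Y 0 3 = y03, Y 1 2 = y12, Y 1 3 = y13, Y 2 3 = y23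
  ext i j
  fin_cases i <;> fin_cases j <;>
    simp [Fin.sum_univ_four, Matrix.trace] <;> ring

-- The Levi-Civita symbol is symmetric under exchange of its two index pairs, so `dual` is
-- self-adjoint for the trace form. This yields the self-adjointness of ⋆.
set_option maxHeartbeats 4000000 in
theorem trace_dual_mul (X Y : Mat4) : (dual X * Y).trace = (X * dual Y).trace := by
  rw [dual_eq, dual_eq]
  simp [Matrix.mul_apply, Matrix.vecMul, dotProduct, Fin.sum_univ_four, Matrix.trace]; ring

theorem dual_apply_of_antisymm {X : Mat4} (h : Xᵀ = -X) (r s : Fin 4) :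
    dual X r s = (!![0, X 2 3, -X 1 3, X 1 2; -X 2 3, 0, X 0 3, -X 0 2;
      X 1 3, -X 0 3, 0, X 0 1; -X 1 2, X 0 2, -X 0 1, 0] : Mat4) r s := by
  have h' : ∀ i j, X j i = -X i j := fun i j => congrFun (congrFun h i) j
  rw [dual_eq]
  fin_cases r <;> fin_cases s <;>
    simp [h' 0 1, h' 0 2, h' 0 3, h' 1 2, h' 1 3, h' 2 3] <;> ring

/-- For a mixed tensor `U^{αβ}_{γδ}` with vanishing traces, dualising both pairs of indices is
transposition. -/
theorem dual_dual_of_traceless (U : Fin 4 → Fin 4 → Fin 4 → Fin 4 → ℝ)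
    (h1 : ∀ a b c d, U b a c d = -U a b c d) (h2 : ∀ a b c d, U a b d c = -U a b c d)
    (h3 : ∀ b d, ∑ a, U a b a d = 0) (m n r s : Fin 4) :
    dual (Matrix.of fun a b => dual (Matrix.of fun c d => U a b c d) r s) m n = U r s m n := by
  have key := fun a b => dual_apply_of_antisymm (X := Matrix.of fun c d => U a b c d)
    (by ext c d; exact h2 a b c d)
  have e1 : ∀ a c d, U a a c d = 0 := fun a c d => by linarith [h1 a a c d]
  have e2 : ∀ a b c, U a b c c = 0 := fun a b c => by linarith [h2 a b c c]
  have h1' : ∀ a b, U r s b a = -U r s a b := h2 r s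
  have a1 := h1 0 1
  have a2 := h1 0 2
  have a3 := h1 0 3
  have a4 := h1 1 2
  have a5 := h1 1 3
  have a6 := h1 2 3
  have b1 := fun c d => h2 c d 0 1
  have b2 := fun c d => h2 c d 0 2
  have b3 := fun c d => h2 c d 0 3
  have b4 := fun c d => h2 c d 1 2
  have b5 := fun c d => h2 c d 1 3
  have b6 := fun c d => h2 c d 2 3
  have t : ∀ b d, U 0 b 0 d + U 1 b 1 d + U 2 b 2 d + U 3 b 3 d = 0 := fun b d => by
    rw [← h3 b d, Fin.sum_univ_four]
  simp only [key, Matrix.of_apply]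
  refine congrFun (congrFun (ext_antisymm (Y := Matrix.of fun m n => U r s m n)
    (dual_antisymm _) (by ext a b; exact h1' a b) ?_) m) n
  intro m n hmn
  rw [dual_apply_of_antisymm (by ext a b; fin_cases r <;> fin_cases s <;> simp [h1 a b])]
  simp only [Matrix.of_apply]
  have t00 := t 0 0
  have t01 := t 0 1
  have t02 := t 0 2
  have t03 := t 0 3
  have t10 := t 1 0
  have t11 := t 1 1
  have t12 := t 1 2
  have t13 := t 1 3
  have t20 := t 2 0
  have t21 := t 2 1
  have t22 := t 2 2
  have t23 := t 2 3
  have t30 := t 3 0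
  have t31 := t 3 1
  have t32 := t 3 2
  have t33 := t 3 3
  clear t h3 key h1 h2 h1'
  simp only [e1, e2, a1, a2, a3, a4, a5, b1, b2, b3, b4, b5, b6, neg_neg, add_zero,
    zero_add] at t00 t01 t02 t03 t10 t11 t12 t13
  simp only [e1, e2, a6, b1, b2, b3, b4, b5, b6, neg_neg, add_zero,
    zero_add] at t20 t21 t22 t23 t30 t31 t32 t33
  -- The double dual is, up to sign, the component of U on the complementary index pairs. Its
  -- difference from the transposed component is a linear combination of the sixteen traces.
  fin_cases m <;> fin_cases n <;> first | exact absurd hmn (by decide) | skip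
  all_goals
    fin_cases r <;> fin_cases s <;> simp [e1, a1, a2, a3, a4, a5, a6] <;>
      linarith

/-- The cyclic sums of a 1-form with values in 2-forms vanish if and only if the divergence of its
dual does. -/
theorem cyclic_sum_eq_zero_iff {C : Fin 4 → Mat4} (hC : ∀ l, (C l)ᵀ = -C l) :
    (∀ l μ ν, C l μ ν + C μ ν l + C ν l μ = 0) ↔ ∀ κ, ∑ l, dual (C l) κ l = 0 := by
  have h' : ∀ l i j, C l j i = -C l i j := fun l i j => congrFun (congrFun (hC l) i) j
  have hd : ∀ l i, C l i i = 0 := fun l i => by linarith [h' l i i]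
  simp only [dual_apply_of_antisymm (hC _), Fin.sum_univ_four]
  constructor
  · intro h κ
    -- Component κ of the divergence of the dual is, up to sign, the cyclic sum over the three
    -- indices other than κ.
    have h0 := h 1 2 3
    have h1 := h 0 2 3
    have h2 := h 0 1 3
    have h3 := h 0 1 2
    fin_cases κ <;> simp <;> linarith [h' 2 1 3, h' 2 0 3, h' 1 0 3, h' 1 0 2]
  · intro h l μ ν
    have h0 := h 0
    have h1 := h 1
    have h2 := h 2
    have h3 := h 3
    simp at h0 h1 h2 h3
    have b1 := fun c => h' c 0 1
    have b2 := fun c => h' c 0 2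
    have b3 := fun c => h' c 0 3
    have b4 := fun c => h' c 1 2
    have b5 := fun c => h' c 1 3
    have b6 := fun c => h' c 2 3
    fin_cases l <;> fin_cases μ <;> fin_cases ν <;> simp [hd, b1, b2, b3, b4, b5, b6] <;> linarith

/-! ### Self-dual forms at a point -/

/-- A symmetric matrix with positive determinant; this is all of positivity that the Hodge star
needs. -/
structure IsMetric (g : Mat4) : Prop where
  symm : gᵀ = g
  det_pos : 0 < g.det

/-- The Hodge star as an operation on matrices. -/
def hodgeStar (g B : Mat4) : Mat4 := √g.det • dual (g⁻¹ * B * g⁻¹)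

/-- The metric pairing of 2-forms, `B_{μν} C^{μν}`. -/
def pair (g B C : Mat4) : ℝ := -(B * g⁻¹ * C * g⁻¹).trace

namespace IsMetric

variable {g : Mat4} (hg : IsMetric g)
include hg

theorem isUnit_det : IsUnit g.det := hg.det_pos.ne'.isUnit

theorem mul_inv : g * g⁻¹ = 1 := mul_nonsing_inv g hg.isUnit_det

theorem inv_mul : g⁻¹ * g = 1 := nonsing_inv_mul g hg.isUnit_det

theorem inv_transpose : g⁻¹ᵀ = g⁻¹ := by rw [transpose_nonsing_inv, hg.symm]

theorem inv_apply_comm (i j : Fin 4) : g⁻¹ i j = g⁻¹ j i :=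
  congrFun (congrFun hg.inv_transpose j) i

theorem sqrt_pos : 0 < √g.det := Real.sqrt_pos.2 hg.det_pos

theorem sqrt_mul_sqrt : √g.det * √g.det = g.det := Real.mul_self_sqrt hg.det_pos.le

theorem raise_antisymm {B : Mat4} (hB : Bᵀ = -B) : (g⁻¹ * B * g⁻¹)ᵀ = -(g⁻¹ * B * g⁻¹) := by
  rw [transpose_mul, transpose_mul, hB, hg.inv_transpose]
  simp only [mul_neg, neg_mul, Matrix.mul_assoc]

theorem hodge_eq_hodgeStar (B : Fin 4 → Fin 4 → ℝ) : hodge g B = hodgeStar g (Matrix.of B) := by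
  rw [hodgeStar, ← congrArg (fun X : Mat4 => √g.det • dual (g⁻¹ * Matrix.of B * X)) hg.inv_transpose]
  exact hodge_eq g (Matrix.of B)

theorem sdProj_apply (B : Fin 4 → Fin 4 → ℝ) (μ ν : Fin 4) :
    sdProj g B μ ν = 1 / 2 * (B μ ν + hodgeStar g (Matrix.of B) μ ν) := by
  simp only [sdProj, hg.hodge_eq_hodgeStar]

theorem lower_raise (B : Mat4) : g * (g⁻¹ * B * g⁻¹) * g = B := by
  rw [Matrix.mul_assoc, Matrix.mul_assoc, Matrix.mul_assoc, hg.inv_mul, Matrix.mul_one,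
    ← Matrix.mul_assoc, hg.mul_inv, Matrix.one_mul]

theorem raise_lower (B : Mat4) : g⁻¹ * (g * B * g) * g⁻¹ = B := by
  rw [Matrix.mul_assoc, Matrix.mul_assoc, Matrix.mul_assoc, hg.mul_inv, Matrix.mul_one,
    ← Matrix.mul_assoc, hg.inv_mul, Matrix.one_mul]

/-- The change-of-basis identity for A = g⁻¹ exchanges raising before dualising for lowering after
it, at the cost of det g⁻¹. Having both forms of ⋆ lets metric factors cancel in ⋆⋆ and in
divergences. -/
theorem hodgeStar_eq_lower_dual {B : Mat4} (hB : Bᵀ = -B) :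
    hodgeStar g B = (√g.det)⁻¹ • (g * dual B * g) := by
  have h := transpose_mul_dual_mul g⁻¹ hB
  rw [hg.inv_transpose] at h
  have h2 : dual (g⁻¹ * B * g⁻¹) = g⁻¹.det • (g * dual B * g) := by
    rw [← hg.lower_raise (dual (g⁻¹ * B * g⁻¹)), h, Matrix.mul_smul, Matrix.smul_mul]
  rw [hodgeStar, h2, smul_smul, det_nonsing_inv, Ring.inverse_eq_inv']
  congr 1
  have := hg.sqrt_pos.ne'
  have h3 := hg.sqrt_mul_sqrt
  generalize √g.det = t at *
  rw [← h3]
  field_simp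

theorem hodgeStar_hodgeStar {B : Mat4} (hB : Bᵀ = -B) : hodgeStar g (hodgeStar g B) = B := by
  rw [hodgeStar, hg.hodgeStar_eq_lower_dual hB, Matrix.mul_smul, Matrix.smul_mul,
    hg.raise_lower, dual_smul, dual_dual hB, smul_smul, mul_inv_cancel₀ hg.sqrt_pos.ne', one_smul]

theorem dual_of_selfDual {B : Mat4} (hB : Bᵀ = -B) (h : hodgeStar g B = B) :
    dual B = √g.det • (g⁻¹ * B * g⁻¹) := by
  conv_lhs => rw [← h, hodgeStar, dual_smul, dual_dual (hg.raise_antisymm hB)]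

/-- For a self-dual form, `dual` is √det g times raising both indices, so the metric-free relation
between X and `dual Y` becomes an anticommutator. In particular orthogonal self-dual forms
anticommute as endomorphisms. -/
theorem clifford {B C : Mat4} (hB : Bᵀ = -B) (hC : Cᵀ = -C) (hB' : hodgeStar g B = B)
    (hC' : hodgeStar g C = C) :
    (B * g⁻¹) * (C * g⁻¹) + (C * g⁻¹) * (B * g⁻¹) = (-(2⁻¹ * pair g B C)) • (1 : Mat4) := by
  have h := mul_dual_add_mul_dual hB hC
  rw [hg.dual_of_selfDual hB hB', hg.dual_of_selfDual hC hC', Matrix.mul_smul, Matrix.mul_smul, ← smul_add,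
    trace_smul, smul_eq_mul, mul_left_comm, ← smul_smul] at h
  have h2 := smul_right_injective Mat4 hg.sqrt_pos.ne' h
  simp only [pair, Matrix.mul_assoc] at h2 ⊢
  rw [h2]; congr 1; ring

end IsMetric

theorem hodgeStar_antisymm (g B : Mat4) : (hodgeStar g B)ᵀ = -hodgeStar g B := by
  rw [hodgeStar, transpose_smul, dual_antisymm, smul_neg]

theorem hodgeStar_add (g B C : Mat4) : hodgeStar g (B + C) = hodgeStar g B + hodgeStar g C := by
  simp only [hodgeStar, mul_add, add_mul, dual_add, smul_add]

theorem hodgeStar_smul (g B : Mat4) (c : ℝ) : hodgeStar g (c • B) = c • hodgeStar g B := by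
  simp only [hodgeStar, Matrix.mul_smul, Matrix.smul_mul, dual_smul]
  rw [smul_comm]

theorem hodgeStar_sum {ι : Type*} (s : Finset ι) (g : Mat4) (B : ι → Mat4) :
    hodgeStar g (∑ i ∈ s, B i) = ∑ i ∈ s, hodgeStar g (B i) := by
  classical
  induction s using Finset.induction_on with
  | empty => simpa using hodgeStar_smul g 0 0
  | insert a s ha ih => rw [Finset.sum_insert ha, Finset.sum_insert ha, hodgeStar_add, ih]

theorem pair_hodgeStar (g B C : Mat4) : pair g (hodgeStar g B) C = pair g B (hodgeStar g C) := by
  have e : ∀ X Y : Mat4, pair g X Y = -(X * (g⁻¹ * Y * g⁻¹)).trace := by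
    intro X Y; simp only [pair, Matrix.mul_assoc]
  have e' : ∀ X Y : Mat4, pair g X Y = -((g⁻¹ * X * g⁻¹) * Y).trace := by
    intro X Y
    rw [pair, trace_mul_comm]
    simp only [Matrix.mul_assoc]
  rw [e, e', hodgeStar, hodgeStar, Matrix.smul_mul, Matrix.mul_smul, trace_smul,
    trace_smul, trace_dual_mul]

/-- `S` is a basis of the self-dual 2-forms of the metric matrix `g` that satisfies the quaternion
algebra. -/
structure IsSDBasis (g : Mat4) (S : Fin 3 → Mat4) : Prop where
  antisymm : ∀ i, (S i)ᵀ = -S i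
  selfDual : ∀ i, hodgeStar g (S i) = S i
  quaternion : ∀ i j, (S i * g⁻¹) * (S j * g⁻¹) =
      (if i = j then (-1 : Mat4) else 0) + ∑ k, eps ![i, j, k] • (S k * g⁻¹)

theorem pair_comm (g B C : Mat4) : pair g B C = pair g C B := by
  rw [pair, pair, Matrix.mul_assoc, trace_mul_comm, ← Matrix.mul_assoc]

theorem pair_add_right (g B C D : Mat4) : pair g B (C + D) = pair g B C + pair g B D := by
  simp only [pair, mul_add, add_mul, trace_add]; ring

theorem pair_smul_right (g B C : Mat4) (c : ℝ) : pair g B (c • C) = c * pair g B C := by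
  simp only [pair, Matrix.mul_smul, Matrix.smul_mul, trace_smul, smul_eq_mul]; ring

theorem pair_sum_right {ι : Type*} (s : Finset ι) (g B : Mat4) (C : ι → Mat4) :
    pair g B (∑ i ∈ s, C i) = ∑ i ∈ s, pair g B (C i) := by
  simp only [pair, Matrix.mul_sum, Finset.sum_mul, trace_sum, Finset.sum_neg_distrib]

namespace IsSDBasis

variable {g : Mat4} {S : Fin 3 → Mat4} (hS : IsSDBasis g S) (hg : IsMetric g)
include hS hg

theorem trace_eq_zero (i : Fin 3) : (S i * g⁻¹).trace = 0 := by
  have h : (S i * g⁻¹).trace = -(S i * g⁻¹).trace := by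
    conv_lhs => rw [← trace_transpose, transpose_mul, hS.antisymm, hg.inv_transpose, trace_mul_comm,
      neg_mul, trace_neg]
  linarith

theorem pair_eq (i j : Fin 3) : pair g (S i) (S j) = if i = j then 4 else 0 := by
  rw [pair, Matrix.mul_assoc, hS.quaternion, trace_add, trace_sum]
  simp only [trace_smul, hS.trace_eq_zero hg, smul_zero, Finset.sum_const_zero, add_zero]
  split_ifs <;> simp

/-- The frame spans the self-dual forms, proved without counting dimensions. The difference D of the
two sides is self-dual and orthogonal to every S i, hence anticommutes with each J_i = S_i g⁻¹.
Since J_2 = J_0 J_1, it also commutes with J_2; so D g⁻¹ J_2 = 0, and J_2 is invertible. The factor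
1/4 is the inverse of the norm `pair g (S i) (S i) = 4`. -/
theorem half_add_hodgeStar {B : Mat4} (hB : Bᵀ = -B) :
    (1 / 2 : ℝ) • (B + hodgeStar g B) = (1 / 4 : ℝ) • ∑ i, pair g (S i) B • S i := by
  set D : Mat4 := (1 / 2 : ℝ) • (B + hodgeStar g B)
    + (-(1 / 4) : ℝ) • ∑ i, pair g (S i) B • S i with hD
  have hDsd : hodgeStar g D = D := by
    rw [hD, hodgeStar_add, hodgeStar_smul, hodgeStar_smul, hodgeStar_add, hodgeStar_sum,
      hg.hodgeStar_hodgeStar hB, add_comm B]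
    simp only [hodgeStar_smul, hS.selfDual]
  have hDa : Dᵀ = -D := by
    rw [← hDsd]; exact hodgeStar_antisymm g D
  have hDp : ∀ i, pair g D (S i) = 0 := by
    intro i
    rw [pair_comm, hD, pair_add_right, pair_smul_right, pair_smul_right, pair_add_right,
      ← pair_hodgeStar, hS.selfDual, pair_sum_right]
    simp only [pair_smul_right, hS.pair_eq hg]
    simp
    ring
  have anti : ∀ i, (D * g⁻¹) * (S i * g⁻¹) = -((S i * g⁻¹) * (D * g⁻¹)) := by
    intro i
    have := hg.clifford hDa (hS.antisymm i) hDsd (hS.selfDual i)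
    rw [hDp, mul_zero, neg_zero, zero_smul] at this
    exact eq_neg_of_add_eq_zero_left this
  have q : (S 0 * g⁻¹) * (S 1 * g⁻¹) = S 2 * g⁻¹ := by
    rw [hS.quaternion 0 1]
    simp [Fin.sum_univ_three, eps_three]
    norm_num
  have q2 : (S 2 * g⁻¹) * (S 2 * g⁻¹) = -1 := by
    rw [hS.quaternion 2 2]
    simp [eps_three]
  have c : (D * g⁻¹) * (S 2 * g⁻¹) = (S 2 * g⁻¹) * (D * g⁻¹) := by
    rw [← q, ← Matrix.mul_assoc, anti, neg_mul, Matrix.mul_assoc (S 0 * g⁻¹), anti, mul_neg,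
      neg_neg, Matrix.mul_assoc (S 0 * g⁻¹) (S 1 * g⁻¹)]
  have z : (D * g⁻¹) * (S 2 * g⁻¹) = 0 := by
    have := anti 2
    rw [← c] at this
    ext i j
    have := congrFun (congrFun this i) j
    simp only [Matrix.neg_apply, Matrix.zero_apply] at this ⊢
    linarith
  have z2 : D * g⁻¹ = 0 := by
    have : (D * g⁻¹) * (S 2 * g⁻¹) * (S 2 * g⁻¹) = 0 := by rw [z, zero_mul]
    rwa [Matrix.mul_assoc, q2, mul_neg, mul_one, neg_eq_zero] at this
  have z3 : D = 0 := by
    have : D * g⁻¹ * g = 0 := by rw [z2, zero_mul]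
    rwa [Matrix.mul_assoc, hg.inv_mul, mul_one] at this
  rw [hD, neg_smul, ← sub_eq_add_neg, sub_eq_zero] at z3
  exact z3

theorem sdProj_eq {B : Fin 4 → Fin 4 → ℝ} (hB : ∀ μ ν, B ν μ = -B μ ν) (μ ν : Fin 4) :
    sdProj g B μ ν = 1 / 4 * ∑ i, pair g (S i) (Matrix.of B) * S i μ ν := by
  have h := congrFun (congrFun (hS.half_add_hodgeStar hg (B := Matrix.of B)
    (by ext i j; exact hB i j)) μ) ν
  rw [hg.sdProj_apply]
  simpa [Matrix.sum_apply] using h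

theorem eq_sum_of_selfDual {B : Mat4} (hB : Bᵀ = -B) (h : hodgeStar g B = B) :
    B = (1 / 4 : ℝ) • ∑ i, pair g (S i) B • S i := by
  rw [← hS.half_add_hodgeStar hg hB, h, ← two_smul ℝ B, smul_smul]
  norm_num

theorem linearIndependent {c : Fin 3 → ℝ} (h : ∑ i, c i • S i = 0) (j : Fin 3) : c j = 0 := by
  have : pair g (S j) (∑ i, c i • S i) = 0 := by rw [h]; simp [pair]
  rw [pair_sum_right] at this
  simpa [pair_smul_right, hS.pair_eq hg] using this

end IsSDBasis

/-! ### Partial derivatives -/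

theorem pd_congr {f h : E4 → ℝ} {x : E4} (e : f =ᶠ[nhds x] h) (l : Fin 4) : pd l f x = pd l h x := by
  rw [pd, pd, e.fderiv_eq]

theorem pd_congr_of_isOpen {U : Set E4} (hU : IsOpen U) {f h : E4 → ℝ} {x : E4} (hx : x ∈ U)
    (e : ∀ y ∈ U, f y = h y) (l : Fin 4) : pd l f x = pd l h x :=
  pd_congr (Filter.eventuallyEq_of_mem (hU.mem_nhds hx) e) l

theorem pd_const (l : Fin 4) (c : ℝ) (x : E4) : pd l (fun _ => c) x = 0 := by
  simp [pd]

section Differentiable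

variable {f h : E4 → ℝ} {x : E4} (l : Fin 4)

theorem pd_add (hf : DifferentiableAt ℝ f x) (hh : DifferentiableAt ℝ h x) :
    pd l (fun y => f y + h y) x = pd l f x + pd l h x := by
  simp only [pd]; rw [fderiv_fun_add hf hh]; rfl

theorem pd_sub (hf : DifferentiableAt ℝ f x) (hh : DifferentiableAt ℝ h x) :
    pd l (fun y => f y - h y) x = pd l f x - pd l h x := by
  simp only [pd]; rw [fderiv_fun_sub hf hh]; rfl

theorem pd_neg : pd l (fun y => -f y) x = -pd l f x := by
  simp only [pd]; rw [fderiv_fun_neg]; rfl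

theorem pd_mul (hf : DifferentiableAt ℝ f x) (hh : DifferentiableAt ℝ h x) :
    pd l (fun y => f y * h y) x = pd l f x * h x + f x * pd l h x := by
  simp only [pd]; rw [fderiv_fun_mul hf hh]
  simp; ring

theorem pd_const_mul (c : ℝ) (hf : DifferentiableAt ℝ f x) :
    pd l (fun y => c * f y) x = c * pd l f x := by
  rw [pd_mul l (differentiableAt_const c) hf, pd_const]; ring

theorem pd_sqrt (hf : DifferentiableAt ℝ f x) (h0 : 0 < f x) :
    pd l (fun y => √(f y)) x = pd l f x / (2 * √(f x)) := by
  simp only [pd]; rw [fderiv_sqrt hf h0.ne']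
  simp; ring

end Differentiable

theorem pd_sum {ι : Type*} (s : Finset ι) {f : ι → E4 → ℝ} {x : E4} (l : Fin 4)
    (hf : ∀ i ∈ s, DifferentiableAt ℝ (f i) x) :
    pd l (fun y => ∑ i ∈ s, f i y) x = ∑ i ∈ s, pd l (f i) x := by
  simp only [pd]; rw [fderiv_fun_sum hf]; simp

theorem ContDiffOn.pd {U : Set E4} (hU : IsOpen U) {f : E4 → ℝ} (hf : ContDiffOn ℝ ∞ f U)
    (l : Fin 4) : ContDiffOn ℝ ∞ (pd l f) U :=
  (hf.fderiv_of_isOpen hU (by simp)).clm_apply contDiffOn_const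

theorem pd_pd_comm {U : Set E4} (hU : IsOpen U) {f : E4 → ℝ} (hf : ContDiffOn ℝ ∞ f U)
    {x : E4} (hx : x ∈ U) (μ ν : Fin 4) : pd μ (pd ν f) x = pd ν (pd μ f) x := by
  have hs : IsSymmSndFDerivAt ℝ f x :=
    (hf.contDiffAt (hU.mem_nhds hx)).isSymmSndFDerivAt
      (by simpa using WithTop.coe_le_coe.2 (le_top (a := (2 : ℕ∞))))
  have hd : DifferentiableAt ℝ (fderiv ℝ f) x :=
    ((hf.fderiv_of_isOpen (m := ∞) hU (by simp)).differentiableOn (by simp)).differentiableAt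
      (hU.mem_nhds hx)
  have e : ∀ v w : E4, fderiv ℝ (fun y => fderiv ℝ f y v) x w = fderiv ℝ (fderiv ℝ f) x w v := by
    intro v w
    rw [fderiv_clm_apply hd (differentiableAt_const v)]
    simp
  change fderiv ℝ (fun y => fderiv ℝ f y _) x _ = fderiv ℝ (fun y => fderiv ℝ f y _) x _
  rw [e, e, hs]

/-! ### Matrix-valued functions -/

/-- The entrywise partial derivative of a matrix-valued function. -/
def pdM (l : Fin 4) (B : E4 → Mat4) (x : E4) : Mat4 := Matrix.of fun i j => pd l (fun y => B y i j) x

/-- Entrywise smoothness of a matrix-valued function. -/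
def EntrySmooth (U : Set E4) (B : E4 → Mat4) : Prop := ∀ i j, ContDiffOn ℝ ∞ (fun y => B y i j) U

/-- Entrywise differentiability of a matrix-valued function. -/
def EntryDiff (x : E4) (B : E4 → Mat4) : Prop := ∀ i j, DifferentiableAt ℝ (fun y => B y i j) x

theorem _root_.ContDiffOn.differentiableAt_of_isOpen {U : Set E4} (hU : IsOpen U) {f : E4 → ℝ}
    (hf : ContDiffOn ℝ ∞ f U) {x : E4} (hx : x ∈ U) : DifferentiableAt ℝ f x :=
  (hf.differentiableOn (by simp)).differentiableAt (hU.mem_nhds hx)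

theorem pdM_congr_of_isOpen {U : Set E4} (hU : IsOpen U) {A B : E4 → Mat4} {x : E4} (hx : x ∈ U)
    (e : ∀ y ∈ U, A y = B y) (l : Fin 4) : pdM l A x = pdM l B x := by
  ext i j
  exact pd_congr_of_isOpen hU hx (fun y hy => by rw [e y hy]) l

theorem pdM_const (l : Fin 4) (C : Mat4) (x : E4) : pdM l (fun _ => C) x = 0 := by
  ext i j; exact pd_const l _ x

namespace EntryDiff

variable {x : E4} {A B : E4 → Mat4} (hA : EntryDiff x A) (hB : EntryDiff x B)

theorem const (C : Mat4) : EntryDiff x fun _ => C := fun _ _ => differentiableAt_const _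

include hA

theorem transpose : EntryDiff x fun y => (A y)ᵀ := fun i j => hA j i

theorem dual : EntryDiff x fun y => dual (A y) := fun i j => by
  simp only [Plebanski.dual, Matrix.of_apply]
  exact (DifferentiableAt.fun_sum fun a _ => DifferentiableAt.fun_sum fun b _ =>
    (hA a b).const_mul _).const_mul _

theorem smul {f : E4 → ℝ} (hf : DifferentiableAt ℝ f x) : EntryDiff x fun y => f y • A y :=
  fun i j => hf.mul (hA i j)

theorem pdM_dual (l : Fin 4) : pdM l (fun y => Plebanski.dual (A y)) x =
    Plebanski.dual (pdM l A x) := by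
  ext i j
  simp only [Plebanski.dual, pdM, Matrix.of_apply]
  rw [pd_const_mul, pd_sum]
  · congr 1
    refine Finset.sum_congr rfl fun a _ => ?_
    rw [pd_sum]
    · exact Finset.sum_congr rfl fun b _ => pd_const_mul l _ (hA a b)
    · exact fun b _ => (hA a b).const_mul _
  · exact fun a _ => DifferentiableAt.fun_sum fun b _ => (hA a b).const_mul _
  · exact DifferentiableAt.fun_sum fun a _ => DifferentiableAt.fun_sum fun b _ =>
      (hA a b).const_mul _

theorem pdM_smul {f : E4 → ℝ} (hf : DifferentiableAt ℝ f x) (l : Fin 4) :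
    pdM l (fun y => f y • A y) x = pd l f x • A x + f x • pdM l A x := by
  ext i j; exact pd_mul l hf (hA i j)

include hB

theorem sub : EntryDiff x fun y => A y - B y := fun i j => (hA i j).sub (hB i j)

theorem mul : EntryDiff x fun y => A y * B y := fun i j => by
  simp only [Matrix.mul_apply]
  exact DifferentiableAt.fun_sum fun k _ => (hA i k).mul (hB k j)

theorem pdM_add (l : Fin 4) : pdM l (fun y => A y + B y) x = pdM l A x + pdM l B x := by
  ext i j; exact pd_add l (hA i j) (hB i j)

theorem pdM_sub (l : Fin 4) : pdM l (fun y => A y - B y) x = pdM l A x - pdM l B x := by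
  ext i j; exact pd_sub l (hA i j) (hB i j)

theorem pdM_mul (l : Fin 4) :
    pdM l (fun y => A y * B y) x = pdM l A x * B x + A x * pdM l B x := by
  ext i j
  simp only [Matrix.mul_apply, Matrix.add_apply, pdM, Matrix.of_apply]
  rw [pd_sum _ _ fun k _ => (hA i k).fun_mul (hB k j), ← Finset.sum_add_distrib]
  exact Finset.sum_congr rfl fun k _ => pd_mul l (hA i k) (hB k j)

end EntryDiff

namespace EntrySmooth

variable {U : Set E4} {A B : E4 → Mat4} (hA : EntrySmooth U A) (hB : EntrySmooth U B)
include hA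

theorem mdiff (hU : IsOpen U) {x : E4} (hx : x ∈ U) : EntryDiff x A :=
  fun i j => (hA i j).differentiableAt_of_isOpen hU hx

theorem transpose : EntrySmooth U fun y => (A y)ᵀ := fun i j => hA j i

theorem pdM (hU : IsOpen U) (l : Fin 4) : EntrySmooth U (pdM l A) := fun i j => ContDiffOn.pd hU (hA i j) l

theorem pdM_pdM_comm (hU : IsOpen U) {x : E4} (hx : x ∈ U) (μ ν : Fin 4) :
    Plebanski.pdM μ (Plebanski.pdM ν A) x = Plebanski.pdM ν (Plebanski.pdM μ A) x := by
  ext i j; exact pd_pd_comm hU (hA i j) hx μ ν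

theorem det : ContDiffOn ℝ ∞ (fun y => (A y).det) U := by
  simp only [Matrix.det_apply]
  exact ContDiffOn.sum fun σ _ => (contDiffOn_prod fun i _ => hA _ _).const_smul _

theorem inv (h0 : ∀ x ∈ U, (A x).det ≠ 0) : EntrySmooth U fun y => (A y)⁻¹ := fun i j => by
  simp only [Matrix.inv_def, Ring.inverse_eq_inv', Matrix.smul_apply, smul_eq_mul]
  refine (hA.det.inv h0).mul ?_
  simp only [Matrix.adjugate_apply]
  refine EntrySmooth.det (A := fun y => (A y).updateRow j (Pi.single i 1)) fun a b => ?_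
  by_cases h : a = j
  · subst h; simp only [Matrix.updateRow_self]; exact contDiffOn_const
  · simp only [Matrix.updateRow_ne h]; exact hA a b

include hB

theorem add : EntrySmooth U fun y => A y + B y := fun i j => (hA i j).add (hB i j)

theorem sub : EntrySmooth U fun y => A y - B y := fun i j => (hA i j).sub (hB i j)

theorem mul : EntrySmooth U fun y => A y * B y := fun i j => by
  simp only [Matrix.mul_apply]
  exact ContDiffOn.sum fun k _ => (hA i k).mul (hB k j)

end EntrySmooth

/-! ### Metrics on an open set and their Levi-Civita connection -/

/-- `G` is a smooth metric on the open set `U`. -/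
structure IsMetricOn (G : E4 → Mat4) (U : Set E4) : Prop where
  isOpen : IsOpen U
  smooth : EntrySmooth U G
  metric : ∀ x ∈ U, IsMetric (G x)

/-- The matrix `Γ_l` of Christoffel symbols, `(Γ_l)^κ_μ = Γ^κ_{lμ}`. -/
def Gam (G : E4 → Mat4) (l : Fin 4) (x : E4) : Mat4 := Matrix.of fun κ μ => christoffel G x κ l μ

/-- The covariant derivative of a covariant 2-tensor field. -/
def covD (G : E4 → Mat4) (l : Fin 4) (B : E4 → Mat4) (x : E4) : Mat4 :=
  pdM l B x - (Gam G l x)ᵀ * B x - B x * Gam G l x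

namespace IsMetricOn

variable {G : E4 → Mat4} {U : Set E4} (hG : IsMetricOn G U)
include hG

theorem mono {V : Set E4} (hV : IsOpen V) (h : V ⊆ U) : IsMetricOn G V :=
  ⟨hV, fun i j => (hG.smooth i j).mono h, fun x hx => hG.metric x (h hx)⟩

theorem apply_comm {x : E4} (hx : x ∈ U) (i j : Fin 4) : G x i j = G x j i :=
  congrFun (congrFun (hG.metric x hx).symm j) i

theorem pd_apply_comm {x : E4} (hx : x ∈ U) (l i j : Fin 4) :
    pd l (fun y => G y i j) x = pd l (fun y => G y j i) x :=
  pd_congr_of_isOpen hG.isOpen hx (fun _ hy => hG.apply_comm hy i j) l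

theorem smooth_inv : EntrySmooth U fun y => (G y)⁻¹ :=
  hG.smooth.inv fun x hx => (hG.metric x hx).det_pos.ne'

theorem christoffel_comm {x : E4} (hx : x ∈ U) (κ l μ : Fin 4) :
    christoffel G x κ l μ = christoffel G x κ μ l := by
  simp only [christoffel]
  congr 1
  refine Finset.sum_congr rfl fun σ _ => ?_
  rw [hG.pd_apply_comm hx σ l μ]; ring

theorem lower_christoffel {x : E4} (hx : x ∈ U) (l μ ν : Fin 4) :
    (G x * Gam G l x) μ ν = 1 / 2 * (pd l (fun y => G y μ ν) x + pd ν (fun y => G y μ l) x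
      - pd μ (fun y => G y l ν) x) := by
  set w : Fin 4 → ℝ := fun σ => 1 / 2 * (pd l (fun y => G y σ ν) x + pd ν (fun y => G y σ l) x
      - pd σ (fun y => G y l ν) x) with hw
  have h1 : ∀ κ, Gam G l x κ ν = ((G x)⁻¹ *ᵥ w) κ := by
    intro κ
    simp only [Gam, Matrix.of_apply, christoffel, Matrix.mulVec, dotProduct, hw, Finset.mul_sum]
    exact Finset.sum_congr rfl fun σ _ => by ring
  calc (G x * Gam G l x) μ ν = (G x *ᵥ ((G x)⁻¹ *ᵥ w)) μ := by
        simp only [Matrix.mul_apply, h1]; rfl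
    _ = w μ := by rw [Matrix.mulVec_mulVec, (hG.metric x hx).mul_inv, Matrix.one_mulVec]

/-- Metric compatibility ∇g = 0: in the symmetrised lowered Christoffel symbols only the derivative
in direction l survives. -/
theorem pdM_metric {x : E4} (hx : x ∈ U) (l : Fin 4) :
    pdM l G x = (Gam G l x)ᵀ * G x + G x * Gam G l x := by
  have h : (Gam G l x)ᵀ * G x = (G x * Gam G l x)ᵀ := by
    rw [transpose_mul, (hG.metric x hx).symm]
  ext μ ν
  rw [h, Matrix.add_apply, Matrix.transpose_apply, hG.lower_christoffel hx,
    hG.lower_christoffel hx, pdM, Matrix.of_apply, hG.pd_apply_comm hx l ν μ,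
    hG.pd_apply_comm hx μ ν l, hG.pd_apply_comm hx ν μ l]
  ring

theorem pdM_inv {x : E4} (hx : x ∈ U) (l : Fin 4) :
    pdM l (fun y => (G y)⁻¹) x = -((G x)⁻¹ * (Gam G l x)ᵀ) - Gam G l x * (G x)⁻¹ := by
  have hx' := hG.metric x hx
  have h := EntryDiff.pdM_mul (hG.smooth_inv.mdiff hG.isOpen hx) (hG.smooth.mdiff hG.isOpen hx) l
  rw [pdM_congr_of_isOpen hG.isOpen hx (fun y hy => (hG.metric y hy).inv_mul) l, pdM_const,
    hG.pdM_metric hx] at h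
  have h2 : pdM l (fun y => (G y)⁻¹) x * G x =
      -((G x)⁻¹ * ((Gam G l x)ᵀ * G x + G x * Gam G l x)) := (neg_eq_of_add_eq_zero_left h.symm).symm
  calc pdM l (fun y => (G y)⁻¹) x = pdM l (fun y => (G y)⁻¹) x * G x * (G x)⁻¹ := by
        rw [Matrix.mul_assoc, hx'.mul_inv, Matrix.mul_one]
    _ = _ := by
        rw [h2, mul_add, ← Matrix.mul_assoc (G x)⁻¹ (G x), hx'.inv_mul, Matrix.one_mul, neg_mul,
          add_mul, Matrix.mul_assoc, Matrix.mul_assoc (_)ᵀ, hx'.mul_inv, Matrix.mul_one]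
        abel

/-- Jacobi's formula combined with ∇g = 0. It is obtained by differentiating the change-of-basis
identity G · dual(G X G) · G = det G · dual X for one fixed bivector X. -/
theorem pd_det {x : E4} (hx : x ∈ U) (l : Fin 4) :
    pd l (fun y => (G y).det) x = 2 * (Gam G l x).trace * (G x).det := by
  -- Any X with nonzero dual would do; here `dual X` has (2,3) entry 1, where the scalar identity is
  -- read off at the end.
  set X : Mat4 := !![0, 1, 0, 0; -1, 0, 0, 0; 0, 0, 0, 0; 0, 0, 0, 0] with hX
  have hXa : Xᵀ = -X := by
    ext i j; fin_cases i <;> fin_cases j <;> simp [hX]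
  have hx' := hG.metric x hx
  have dG := hG.smooth.mdiff hG.isOpen hx
  have dd := hG.smooth.det.differentiableAt_of_isOpen hG.isOpen hx
  have id : ∀ y ∈ U, G y * dual (G y * X * G y) * G y = (G y).det • dual X := fun y hy => by
    have := transpose_mul_dual_mul (G y) hXa
    rwa [(hG.metric y hy).symm] at this
  have h := pdM_congr_of_isOpen hG.isOpen hx id l
  have dX : EntryDiff x fun _ => X := EntryDiff.const X
  have dX' : EntryDiff x fun _ => dual X := EntryDiff.const _
  have d1 := (dG.mul dX).mul dG
  rw [EntryDiff.pdM_mul (dG.mul d1.dual) dG, EntryDiff.pdM_mul dG d1.dual, d1.pdM_dual,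
    EntryDiff.pdM_mul (dG.mul dX) dG, EntryDiff.pdM_mul dG dX, pdM_const, dX'.pdM_smul dd, pdM_const,
    hG.pdM_metric hx] at h
  have hY : (G x * X * G x)ᵀ = -(G x * X * G x) := by
    rw [transpose_mul, transpose_mul, hx'.symm, hXa]
    simp only [neg_mul, mul_neg, Matrix.mul_assoc]
  have hZ : (Gam G l x * X + X * (Gam G l x)ᵀ)ᵀ = -(Gam G l x * X + X * (Gam G l x)ᵀ) := by
    rw [transpose_add, transpose_mul, transpose_mul, hXa, transpose_transpose]
    simp only [neg_mul, mul_neg]; abel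
  have e1 : (((Gam G l x)ᵀ * G x + G x * Gam G l x) * X + G x * 0) * G x +
      G x * X * ((Gam G l x)ᵀ * G x + G x * Gam G l x) =
      ((Gam G l x)ᵀ * (G x * X * G x) + (G x * X * G x) * (Gam G l x)ᵀᵀ)
        + G x * (Gam G l x * X + X * (Gam G l x)ᵀ) * G x := by
    rw [transpose_transpose]; noncomm_ring
  have e2 := dual_mul_add_mul_transpose (Gam G l x)ᵀ hY
  have e3 := transpose_mul_dual_mul (G x) hZ
  rw [hx'.symm, dual_mul_add_mul_transpose _ hXa] at e3
  have e4 := id x hx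
  rw [e1, dual_add, e2, trace_transpose, transpose_transpose] at h
  have e5 : pd l (fun y => (G y).det) x • dual X
      = (2 * (Gam G l x).trace * (G x).det) • dual X := by
    have : pd l (fun y => (G y).det) x • dual X =
        (Gam G l x)ᵀ * (G x * dual (G x * X * G x) * G x)
        + (G x * dual (G x * X * G x) * G x) * Gam G l x
        + (Gam G l x).trace • (G x * dual (G x * X * G x) * G x)
        + G x * dual (G x * (Gam G l x * X + X * (Gam G l x)ᵀ) * G x) * G x := by
      rw [smul_zero, add_zero] at h
      rw [← h]
      generalize dual (G x * X * G x) = D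
      generalize dual (G x * (Gam G l x * X + X * (Gam G l x)ᵀ) * G x) = D'
      simp only [mul_add, add_mul, mul_sub, sub_mul, Matrix.mul_smul, Matrix.smul_mul,
        Matrix.mul_assoc]
      abel
    rw [this, e3, e4]
    simp only [smul_sub, Matrix.mul_smul, Matrix.smul_mul, smul_smul]
    module
  have := congrFun (congrFun e5 2) 3
  simpa [dual_eq, hX] using this

theorem pd_sqrt_det {x : E4} (hx : x ∈ U) (l : Fin 4) :
    pd l (fun y => √(G y).det) x = (Gam G l x).trace * √(G x).det := by
  have hx' := hG.metric x hx
  rw [pd_sqrt l (hG.smooth.det.differentiableAt_of_isOpen hG.isOpen hx) hx'.det_pos, hG.pd_det hx]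
  have h3 := hx'.sqrt_mul_sqrt
  have := hx'.sqrt_pos.ne'
  field_simp
  rw [sq, h3]

theorem differentiableAt_sqrt_det {x : E4} (hx : x ∈ U) :
    DifferentiableAt ℝ (fun y => √(G y).det) x :=
  (hG.smooth.det.differentiableAt_of_isOpen hG.isOpen hx).sqrt (hG.metric x hx).det_pos.ne'

/-- The Hodge star is parallel. -/
theorem covD_hodgeStar {x : E4} (hx : x ∈ U) {B : E4 → Mat4} (hB : EntryDiff x B)
    (hBa : (B x)ᵀ = -B x) (l : Fin 4) :
    covD G l (fun y => hodgeStar (G y) (B y)) x = hodgeStar (G x) (covD G l B x) := by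
  have hx' := hG.metric x hx
  have dH := hG.smooth_inv.mdiff hG.isOpen hx
  have d1 := (dH.mul hB).mul dH
  have e : pdM l (fun y => hodgeStar (G y) (B y)) x =
      ((Gam G l x).trace * √(G x).det) • dual ((G x)⁻¹ * B x * (G x)⁻¹) + √(G x).det •
      dual (((-((G x)⁻¹ * (Gam G l x)ᵀ) - Gam G l x * (G x)⁻¹) * B x + (G x)⁻¹ * pdM l B x)
        * (G x)⁻¹ + (G x)⁻¹ * B x * (-((G x)⁻¹ * (Gam G l x)ᵀ) - Gam G l x * (G x)⁻¹)) := by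
    simp only [hodgeStar]
    rw [d1.dual.pdM_smul (hG.differentiableAt_sqrt_det hx), d1.pdM_dual,
      EntryDiff.pdM_mul (dH.mul hB) dH, EntryDiff.pdM_mul dH hB, hG.pdM_inv hx, hG.pd_sqrt_det hx]
  rw [covD, e, hodgeStar, hodgeStar, covD]
  have e2 := dual_mul_add_mul_transpose (Gam G l x) (hx'.raise_antisymm hBa)
  -- The derivative of the raised form Y is the raised ∇B minus ΓY + YΓᵀ. Dualising the latter by
  -- `e2` produces a trace term that cancels the derivative of √det g, and the connection terms of
  -- ∇(⋆B).
  have e3 : ((-((G x)⁻¹ * (Gam G l x)ᵀ) - Gam G l x * (G x)⁻¹) * B x + (G x)⁻¹ * pdM l B x)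
        * (G x)⁻¹ + (G x)⁻¹ * B x * (-((G x)⁻¹ * (Gam G l x)ᵀ) - Gam G l x * (G x)⁻¹) =
      (G x)⁻¹ * (pdM l B x - (Gam G l x)ᵀ * B x - B x * Gam G l x) * (G x)⁻¹
      + -(Gam G l x * ((G x)⁻¹ * B x * (G x)⁻¹) + (G x)⁻¹ * B x * (G x)⁻¹ * (Gam G l x)ᵀ) := by
    noncomm_ring
  rw [e3, dual_add, dual_neg, e2]
  simp only [Matrix.mul_smul, Matrix.smul_mul]
  module

end IsMetricOn

/-! ### Curvature -/

/-- The curvature endomorphism `(R_{μν})^ρ_σ = R^ρ_{σμν}`. -/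
def curvM (G : E4 → Mat4) (μ ν : Fin 4) (x : E4) : Mat4 :=
  pdM μ (Gam G ν) x - pdM ν (Gam G μ) x + (Gam G μ x * Gam G ν x - Gam G ν x * Gam G μ x)

theorem riemannUp_eq (G : E4 → Mat4) (x : E4) (ρ σ μ ν : Fin 4) :
    riemannUp G x ρ σ μ ν = curvM G μ ν x ρ σ := by
  simp only [riemannUp, curvM, Matrix.add_apply, Matrix.sub_apply, Matrix.mul_apply, pdM, Gam,
    Matrix.of_apply, Finset.sum_sub_distrib]

theorem riemann_eq (G : E4 → Mat4) (x : E4) (ρ σ μ ν : Fin 4) :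
    riemann G x ρ σ μ ν = (G x * curvM G μ ν x) ρ σ := by
  simp only [riemann, Matrix.mul_apply, riemannUp_eq]

theorem curvM_antisymm (G : E4 → Mat4) (μ ν : Fin 4) (x : E4) :
    curvM G ν μ x = -curvM G μ ν x := by
  simp only [curvM]; abel

/-- The covariant derivative of a 4-tensor as that of the matrices of its first two indices. -/
theorem covDeriv_eq (G : E4 → Mat4) (T : E4 → Fin 4 → Fin 4 → Fin 4 → Fin 4 → ℝ) (x : E4)
    (l μ ν ρ σ : Fin 4) : covDeriv G T x l μ ν ρ σ =
      covD G l (fun y => Matrix.of fun a b => T y a b ρ σ) x μ ν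
        - ∑ κ, (Gam G l x κ ρ * T x μ ν κ σ + Gam G l x κ σ * T x μ ν ρ κ) := by
  simp only [covDeriv, covD, Matrix.sub_apply, Matrix.mul_apply, Matrix.transpose_apply, pdM, Gam,
    Matrix.of_apply, Finset.sum_add_distrib]
  have : ∀ κ, T x μ κ ρ σ * christoffel G x κ l ν = christoffel G x κ l ν * T x μ κ ρ σ :=
    fun κ => mul_comm _ _
  simp only [this]
  ring

/-- The covariant derivative of a 4-tensor as that of the matrices of its first and third
index. -/
theorem covDeriv_eq_first_third (G : E4 → Mat4) (T : E4 → Fin 4 → Fin 4 → Fin 4 → Fin 4 → ℝ)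
    (x : E4) (l μ ν ρ σ : Fin 4) : covDeriv G T x l μ ν ρ σ =
      covD G l (fun y => Matrix.of fun a b => T y a ν b σ) x μ ρ
        - ∑ κ, (Gam G l x κ ν * T x μ κ ρ σ + Gam G l x κ σ * T x μ ν ρ κ) := by
  simp only [covDeriv, covD, Matrix.sub_apply, Matrix.mul_apply, Matrix.transpose_apply, pdM, Gam,
    Matrix.of_apply, Finset.sum_add_distrib]
  have : ∀ κ, T x μ ν κ σ * christoffel G x κ l ρ = christoffel G x κ l ρ * T x μ ν κ σ :=
    fun κ => mul_comm _ _
  simp only [this]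
  ring

namespace IsMetricOn

variable {G : E4 → Mat4} {U : Set E4} (hG : IsMetricOn G U)
include hG

theorem smooth_Gam (l : Fin 4) : EntrySmooth U (Gam G l) := fun κ μ => by
  simp only [Gam, Matrix.of_apply, christoffel]
  refine contDiffOn_const.mul (ContDiffOn.sum fun σ _ => (hG.smooth_inv κ σ).mul ?_)
  exact ((ContDiffOn.pd hG.isOpen (hG.smooth _ _) _).add
    (ContDiffOn.pd hG.isOpen (hG.smooth _ _) _)).sub (ContDiffOn.pd hG.isOpen (hG.smooth _ _) _)

theorem smooth_curvM (μ ν : Fin 4) : EntrySmooth U (curvM G μ ν) :=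
  (((hG.smooth_Gam ν).pdM hG.isOpen μ).sub ((hG.smooth_Gam μ).pdM hG.isOpen ν)).add
    (((hG.smooth_Gam μ).mul (hG.smooth_Gam ν)).sub ((hG.smooth_Gam ν).mul (hG.smooth_Gam μ)))

theorem smooth_riemann (ρ σ μ ν : Fin 4) :
    ContDiffOn ℝ ∞ (fun y => riemann G y ρ σ μ ν) U := by
  simp only [riemann_eq]
  exact (hG.smooth.mul (hG.smooth_curvM μ ν)) ρ σ

theorem smooth_ricci (σ ν : Fin 4) : ContDiffOn ℝ ∞ (fun y => ricci G y σ ν) U := by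
  simp only [ricci, riemannUp_eq]
  exact ContDiffOn.sum fun ρ _ => hG.smooth_curvM _ _ _ _

theorem smooth_weyl (ρ σ μ ν : Fin 4) : ContDiffOn ℝ ∞ (fun y => weyl G y ρ σ μ ν) U := by
  have hr := hG.smooth_ricci
  have hg := hG.smooth
  have hs : ContDiffOn ℝ ∞ (fun y => scalarCurv G y) U := by
    simp only [scalarCurv]
    exact ContDiffOn.sum fun a _ => ContDiffOn.sum fun b _ => (hG.smooth_inv a b).mul (hr a b)
  simp only [weyl]
  refine ((hG.smooth_riemann ρ σ μ ν).sub (contDiffOn_const.mul ?_)).add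
    ((hs.div_const 6).mul (((hg ρ μ).mul (hg σ ν)).sub ((hg ρ ν).mul (hg σ μ))))
  exact ((((hg ρ μ).mul (hr σ ν)).sub ((hg ρ ν).mul (hr σ μ))).add
    ((hg σ ν).mul (hr ρ μ))).sub ((hg σ μ).mul (hr ρ ν))

/-- Second partial derivatives of G commute. Expanding both orders by ∇g = 0, their difference is
RᵀG + GR. -/
theorem curvM_metric {x : E4} (hx : x ∈ U) (μ ν : Fin 4) :
    (curvM G μ ν x)ᵀ * G x = -(G x * curvM G μ ν x) := by
  have dG := hG.smooth.mdiff hG.isOpen hx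
  have dΓ := fun l => (hG.smooth_Gam l).mdiff hG.isOpen hx
  have e : ∀ a b, pdM a (pdM b G) x = (pdM a (Gam G b) x)ᵀ * G x
      + (Gam G b x)ᵀ * ((Gam G a x)ᵀ * G x + G x * Gam G a x)
      + (((Gam G a x)ᵀ * G x + G x * Gam G a x) * Gam G b x + G x * pdM a (Gam G b) x) := by
    intro a b
    rw [pdM_congr_of_isOpen hG.isOpen hx (fun y hy => hG.pdM_metric hy b) a,
      EntryDiff.pdM_add ((dΓ b).transpose.mul dG) (dG.mul (dΓ b)), EntryDiff.pdM_mul dG (dΓ b),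
      EntryDiff.pdM_mul (dΓ b).transpose dG, hG.pdM_metric hx]
    rfl
  have h := hG.smooth.pdM_pdM_comm hG.isOpen hx μ ν
  rw [e, e] at h
  rw [← sub_eq_zero] at h
  rw [← sub_eq_zero, ← h]
  simp only [curvM, transpose_add, transpose_sub, transpose_mul]
  noncomm_ring

theorem riemann_antisymm_left {x : E4} (hx : x ∈ U) (ρ σ μ ν : Fin 4) :
    riemann G x σ ρ μ ν = -riemann G x ρ σ μ ν := by
  have h := congrFun (congrFun (hG.curvM_metric hx μ ν) ρ) σ
  rw [riemann_eq, riemann_eq, ← Matrix.neg_apply, ← h, ← (hG.metric x hx).symm, ← transpose_mul,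
    (hG.metric x hx).symm]
  rfl

omit hG in
theorem _root_.Plebanski.riemann_antisymm_right (G : E4 → Mat4) (x : E4) (ρ σ μ ν : Fin 4) :
    riemann G x ρ σ ν μ = -riemann G x ρ σ μ ν := by
  rw [riemann_eq, riemann_eq, curvM_antisymm, mul_neg, Matrix.neg_apply]

theorem pd_Gam_comm {x : E4} (hx : x ∈ U) (a κ l μ : Fin 4) :
    pdM a (Gam G l) x κ μ = pdM a (Gam G μ) x κ l :=
  pd_congr_of_isOpen hG.isOpen hx (fun _ hy => hG.christoffel_comm hy κ l μ) a

/-- The first Bianchi identity. -/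
theorem riemann_cyclic {x : E4} (hx : x ∈ U) (ρ σ μ ν : Fin 4) :
    riemann G x ρ σ μ ν + riemann G x ρ μ ν σ + riemann G x ρ ν σ μ = 0 := by
  have key : ∀ κ, curvM G μ ν x κ σ + curvM G ν σ x κ μ + curvM G σ μ x κ ν = 0 := by
    intro κ
    have c : ∀ a b c, Gam G a x b c = Gam G c x b a := fun a b c => hG.christoffel_comm hx b a c
    simp only [curvM, Matrix.add_apply, Matrix.sub_apply, Matrix.mul_apply]
    rw [hG.pd_Gam_comm hx μ κ ν σ, hG.pd_Gam_comm hx ν κ μ σ, hG.pd_Gam_comm hx σ κ ν μ]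
    simp only [c ν _ σ, c μ _ σ, c ν _ μ]
    ring
  simp only [riemann_eq, Matrix.mul_apply, ← Finset.sum_add_distrib, ← mul_add, key, mul_zero,
    Finset.sum_const_zero]

/-- A linear consequence of four instances of the first Bianchi identity and the two antisymmetries.
-/
theorem riemann_pair {x : E4} (hx : x ∈ U) (ρ σ μ ν : Fin 4) :
    riemann G x ρ σ μ ν = riemann G x μ ν ρ σ := by
  have l := hG.riemann_antisymm_left hx
  have r := riemann_antisymm_right G x
  have c := hG.riemann_cyclic hx
  linarith [c ρ σ μ ν, c σ μ ν ρ, c μ ν ρ σ, c ν ρ σ μ, l ρ σ μ ν, l ρ μ ν σ, l ρ ν σ μ,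
    l σ μ ν ρ, l σ ν ρ μ, l μ ν ρ σ, l ν ρ σ μ, l ν σ μ ρ, l ν μ ρ σ, l μ σ ρ ν, l μ ρ σ ν,
    l σ μ ρ ν, r ρ σ μ ν, r ρ μ ν σ, r ρ ν σ μ, r σ μ ν ρ, r σ ν ρ μ, r σ ρ μ ν, r μ ν ρ σ,
    r μ ρ σ ν, r μ σ ν ρ, r ν ρ σ μ, r ν σ μ ρ, r ν μ ρ σ]

/-- The second Bianchi identity. -/
theorem covDeriv_riemann_cyclic {x : E4} (hx : x ∈ U) (ρ σ l μ ν : Fin 4) :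
    covDeriv G (riemann G) x l ρ σ μ ν + covDeriv G (riemann G) x μ ρ σ ν l
      + covDeriv G (riemann G) x ν ρ σ l μ = 0 := by
  have dG := hG.smooth.mdiff hG.isOpen hx
  have dΓ := fun l => (hG.smooth_Gam l).mdiff hG.isOpen hx
  have dR := fun μ ν => (hG.smooth_curvM μ ν).mdiff hG.isOpen hx
  -- Since ∇g = 0, lowering the index passes through the derivative, leaving ∂R + [Γ, R] for the
  -- curvature endomorphism.
  have e1 : ∀ a b c, covD G a (fun y => Matrix.of fun ρ σ => riemann G y ρ σ b c) x =
      G x * (pdM a (curvM G b c) x + Gam G a x * curvM G b c x - curvM G b c x * Gam G a x) := by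
    intro a b c
    have : (fun y => Matrix.of fun ρ σ => riemann G y ρ σ b c) = fun y => G y * curvM G b c y := by
      funext y; ext i j; exact riemann_eq G y i j b c
    rw [this, covD, EntryDiff.pdM_mul dG (dR b c), hG.pdM_metric hx]
    noncomm_ring
  have e2 : ∀ a b c, pdM a (curvM G b c) x = pdM a (pdM b (Gam G c)) x - pdM a (pdM c (Gam G b)) x
      + ((pdM a (Gam G b) x * Gam G c x + Gam G b x * pdM a (Gam G c) x)
        - (pdM a (Gam G c) x * Gam G b x + Gam G c x * pdM a (Gam G b) x)) := by
    intro a b c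
    have s1 := ((hG.smooth_Gam c).pdM hG.isOpen b).mdiff hG.isOpen hx
    have s2 := ((hG.smooth_Gam b).pdM hG.isOpen c).mdiff hG.isOpen hx
    rw [← EntryDiff.pdM_mul (dΓ b) (dΓ c), ← EntryDiff.pdM_mul (dΓ c) (dΓ b),
      ← EntryDiff.pdM_sub s1 s2, ← EntryDiff.pdM_sub ((dΓ b).mul (dΓ c)) ((dΓ c).mul (dΓ b)),
      ← EntryDiff.pdM_add (s1.sub s2) (((dΓ b).mul (dΓ c)).sub ((dΓ c).mul (dΓ b)))]
    rfl
  have e3 : ∀ a b c, pdM a (pdM b (Gam G c)) x = pdM b (pdM a (Gam G c)) x := fun a b c =>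
    (hG.smooth_Gam c).pdM_pdM_comm hG.isOpen hx a b
  have key : (pdM l (curvM G μ ν) x + Gam G l x * curvM G μ ν x - curvM G μ ν x * Gam G l x)
      + (pdM μ (curvM G ν l) x + Gam G μ x * curvM G ν l x - curvM G ν l x * Gam G μ x)
      + (pdM ν (curvM G l μ) x + Gam G ν x * curvM G l μ x - curvM G l μ x * Gam G ν x) = 0 := by
    rw [e2, e2, e2, e3 μ l ν, e3 ν l μ, e3 ν μ l]
    simp only [curvM]
    noncomm_ring
  have key2 := congrFun (congrFun (congrArg (fun X => G x * X) key) ρ) σ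
  simp only [mul_zero, mul_add (G x), Matrix.add_apply (G x * _),
    Matrix.add_apply (G x * _ + G x * _), Matrix.zero_apply] at key2
  rw [covDeriv_eq, covDeriv_eq, covDeriv_eq, e1, e1, e1]
  have c : ∀ a b c, Gam G a x b c = Gam G c x b a := fun a b c => hG.christoffel_comm hx b a c
  have r := riemann_antisymm_right G x ρ σ
  -- The Christoffel terms on the form indices cancel in the cyclic sum because Γ is symmetric and R
  -- is antisymmetric in those indices.
  have z : ∀ κ, (Gam G l x κ μ * riemann G x ρ σ κ ν + Gam G l x κ ν * riemann G x ρ σ μ κ)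
      + (Gam G μ x κ ν * riemann G x ρ σ κ l + Gam G μ x κ l * riemann G x ρ σ ν κ)
      + (Gam G ν x κ l * riemann G x ρ σ κ μ + Gam G ν x κ μ * riemann G x ρ σ l κ) = 0 := by
    intro κ
    rw [c μ κ l, c ν κ l, c ν κ μ, r ν κ, r κ μ, r κ l]
    ring
  have z2 := Finset.sum_congr (rfl : (Finset.univ : Finset (Fin 4)) = _) fun κ _ => z κ
  rw [Finset.sum_add_distrib, Finset.sum_add_distrib, Finset.sum_const_zero] at z2
  linarith

/-! ### Symmetries and traces of the Ricci and Weyl tensors. -/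

theorem ricci_eq {x : E4} (hx : x ∈ U) (σ ν : Fin 4) :
    ricci G x σ ν = ∑ ρ, ∑ κ, (G x)⁻¹ ρ κ * riemann G x κ σ ρ ν := by
  have hx' := hG.metric x hx
  simp only [ricci, riemannUp_eq]
  refine Finset.sum_congr rfl fun ρ _ => ?_
  have : curvM G ρ ν x = (G x)⁻¹ * (G x * curvM G ρ ν x) := by
    rw [← Matrix.mul_assoc, hx'.inv_mul, Matrix.one_mul]
  rw [this, Matrix.mul_apply]
  simp only [riemann_eq]

theorem ricci_comm {x : E4} (hx : x ∈ U) (σ ν : Fin 4) : ricci G x σ ν = ricci G x ν σ := by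
  rw [hG.ricci_eq hx, hG.ricci_eq hx, Finset.sum_comm]
  refine Finset.sum_congr rfl fun ρ _ => Finset.sum_congr rfl fun κ _ => ?_
  rw [hG.riemann_pair hx, (hG.metric x hx).inv_apply_comm]

theorem weyl_antisymm_left {x : E4} (hx : x ∈ U) (ρ σ μ ν : Fin 4) :
    weyl G x σ ρ μ ν = -weyl G x ρ σ μ ν := by
  simp only [weyl]; rw [hG.riemann_antisymm_left hx]; ring

omit hG in
theorem _root_.Plebanski.weyl_antisymm_right (G : E4 → Mat4) (x : E4) (ρ σ μ ν : Fin 4) :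
    weyl G x ρ σ ν μ = -weyl G x ρ σ μ ν := by
  simp only [weyl]; rw [riemann_antisymm_right G x]; ring

theorem weyl_pair {x : E4} (hx : x ∈ U) (ρ σ μ ν : Fin 4) :
    weyl G x ρ σ μ ν = weyl G x μ ν ρ σ := by
  simp only [weyl]
  rw [hG.riemann_pair hx, hG.apply_comm hx ρ μ, hG.apply_comm hx ρ ν, hG.apply_comm hx σ μ,
    hG.apply_comm hx σ ν, hG.ricci_comm hx ρ μ, hG.ricci_comm hx ρ ν, hG.ricci_comm hx σ μ,
    hG.ricci_comm hx σ ν]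
  ring

theorem weyl_cyclic {x : E4} (hx : x ∈ U) (ρ σ μ ν : Fin 4) :
    weyl G x ρ σ μ ν + weyl G x ρ μ ν σ + weyl G x ρ ν σ μ = 0 := by
  have h := hG.riemann_cyclic hx ρ σ μ ν
  simp only [weyl]
  rw [hG.apply_comm hx σ μ, hG.apply_comm hx σ ν, hG.apply_comm hx μ ν, hG.ricci_comm hx σ μ,
    hG.ricci_comm hx σ ν, hG.ricci_comm hx μ ν]
  linarith

/-- With R the scalar curvature, the trace is Ric - ½(4 Ric - Ric + R g - Ric) + (R/6)(4g - g) = 0;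
the coefficients 1/2 and 1/6 are specific to dimension four. -/
theorem weyl_trace {x : E4} (hx : x ∈ U) (σ ν : Fin 4) :
    ∑ ρ, ∑ μ, (G x)⁻¹ ρ μ * weyl G x μ σ ρ ν = 0 := by
  have hx' := hG.metric x hx
  have t1 : ∀ f : Fin 4 → ℝ, ∀ a, ∑ ρ, ∑ μ, (G x)⁻¹ ρ μ * (G x μ a * f ρ) = f a := by
    intro f a
    have : ∀ ρ, ∑ μ, (G x)⁻¹ ρ μ * (G x μ a * f ρ) = (1 : Mat4) ρ a * f ρ := by
      intro ρ
      rw [← hx'.inv_mul, Matrix.mul_apply, Finset.sum_mul]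
      exact Finset.sum_congr rfl fun _ _ => by ring
    simp [this, Matrix.one_apply]
  have t2 : ∀ f : Fin 4 → ℝ, ∀ a, ∑ ρ, ∑ μ, (G x)⁻¹ ρ μ * (G x a ρ * f μ) = f a := by
    intro f a
    rw [Finset.sum_comm, ← t1 f a]
    refine Finset.sum_congr rfl fun ρ _ => Finset.sum_congr rfl fun μ _ => ?_
    rw [hx'.inv_apply_comm, hG.apply_comm hx]
  have t3 : ∑ ρ, ∑ μ, (G x)⁻¹ ρ μ * G x μ ρ = 4 := by
    have : ∀ ρ, ∑ μ, (G x)⁻¹ ρ μ * G x μ ρ = 1 := fun ρ => by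
      rw [← Matrix.mul_apply, hx'.inv_mul, Matrix.one_apply_eq]
    simp [this]
  have t4 : ∑ ρ, ∑ μ, (G x)⁻¹ ρ μ * ricci G x μ ρ = scalarCurv G x := by
    simp only [scalarCurv]
    refine Finset.sum_congr rfl fun ρ _ => Finset.sum_congr rfl fun μ _ => ?_
    rw [hG.ricci_comm hx]
  have e : ∀ ρ μ, (G x)⁻¹ ρ μ * weyl G x μ σ ρ ν = (G x)⁻¹ ρ μ * riemann G x μ σ ρ ν
      - 1 / 2 * (((G x)⁻¹ ρ μ * G x μ ρ) * ricci G x σ ν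
        - (G x)⁻¹ ρ μ * (G x μ ν * ricci G x σ ρ)
        + ((G x)⁻¹ ρ μ * ricci G x μ ρ) * G x σ ν - (G x)⁻¹ ρ μ * (G x σ ρ * ricci G x μ ν))
      + scalarCurv G x / 6 * (((G x)⁻¹ ρ μ * G x μ ρ) * G x σ ν
        - (G x)⁻¹ ρ μ * (G x μ ν * G x σ ρ)) := by
    intro ρ μ; simp only [weyl]; ring
  simp only [e, Finset.sum_add_distrib, Finset.sum_sub_distrib, ← Finset.mul_sum, ← Finset.sum_mul]
  rw [← hG.ricci_eq hx, t1 (fun ρ => ricci G x σ ρ), t2 (fun μ => ricci G x μ ν), t3, t4,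
    t1 (fun ρ => G x σ ρ)]
  ring

end IsMetricOn

/-! ### The Hodge star on curvature-like tensors and divergences -/

namespace IsMetric

variable {g : Mat4} (hg : IsMetric g)
include hg

/-- For a traceless tensor with the symmetries of the curvature, the Hodge stars in the two pairs of
indices are inverse to each other. -/
theorem hodgeStar_hodgeStar_of_traceless {W : Fin 4 → Fin 4 → Fin 4 → Fin 4 → ℝ}
    (h1 : ∀ a b c d, W b a c d = -W a b c d) (h2 : ∀ a b c d, W a b d c = -W a b c d)
    (h3 : ∀ a b c d, W a b c d = W c d a b)
    (h4 : ∀ b d, ∑ a, ∑ c, g⁻¹ a c * W c b a d = 0) (μ ν ρ σ : Fin 4) :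
    hodgeStar g (Matrix.of fun a b => hodgeStar g (Matrix.of fun c d => W a b c d) ρ σ) μ ν
      = W μ ν ρ σ := by
  -- U is W with its first pair raised. The outer star raises this pair before dualising, and the
  -- inner star is written as a lowered dual. The factors √det g cancel, so `dual_dual_of_traceless`
  -- applies to U.
  set U : Fin 4 → Fin 4 → Fin 4 → Fin 4 → ℝ :=
    fun a b c d => (g⁻¹ * (Matrix.of fun a b => W a b c d) * g⁻¹) a b with hU
  have a2 : ∀ a b, (Matrix.of fun c d => W a b c d)ᵀ = -(Matrix.of fun c d => W a b c d) := by
    intro a b; ext i j; exact h2 a b i j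
  have a1 : ∀ c d, (Matrix.of fun a b => W a b c d)ᵀ = -(Matrix.of fun a b => W a b c d) := by
    intro c d; ext i j; exact h1 i j c d
  have inner : (Matrix.of fun a b => hodgeStar g (Matrix.of fun c d => W a b c d) ρ σ) =
      (√g.det)⁻¹ • ∑ s, ∑ r, (g ρ r * g s σ) •
        (Matrix.of fun a b => dual (Matrix.of fun c d => W a b c d) r s) := by
    ext a b
    rw [Matrix.of_apply, hg.hodgeStar_eq_lower_dual (a2 a b)]
    simp only [Matrix.smul_apply, Matrix.mul_apply, Matrix.sum_apply, Finset.sum_mul, smul_eq_mul,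
      Matrix.of_apply]
    congr 1
    exact Finset.sum_congr rfl fun _ _ => Finset.sum_congr rfl fun _ _ => by ring
  have swap : ∀ r s, g⁻¹ * (Matrix.of fun a b => dual (Matrix.of fun c d => W a b c d) r s) * g⁻¹ =
      Matrix.of fun a b => dual (Matrix.of fun c d => U a b c d) r s := by
    intro r s
    have e : (Matrix.of fun a b => dual (Matrix.of fun c d => W a b c d) r s) =
        ∑ c, ∑ d, (1 / 2 * eps ![r, s, c, d]) • (Matrix.of fun a b => W a b c d) := by
      ext a b
      simp only [dual, Matrix.of_apply, Matrix.sum_apply, Matrix.smul_apply, smul_eq_mul,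
        Finset.mul_sum, mul_assoc]
    rw [e]
    ext a b
    simp only [Finset.sum_mul, Matrix.mul_smul, Matrix.smul_mul, Matrix.sum_apply,
      Matrix.smul_apply, smul_eq_mul, Matrix.of_apply, dual, hU, Finset.mul_sum, mul_assoc]
  have u1 : ∀ a b c d, U b a c d = -U a b c d := fun a b c d =>
    congrFun (congrFun (hg.raise_antisymm (a1 c d)) a) b
  have u2 : ∀ a b c d, U a b d c = -U a b c d := by
    intro a b c d
    have : (Matrix.of fun a b => W a b d c) = -(Matrix.of fun a b => W a b c d) := by
      ext i j; exact h2 i j c d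
    simp only [hU]
    rw [this, mul_neg, neg_mul]; rfl
  have u3 : ∀ b d, ∑ a, U a b a d = 0 := by
    intro b d
    simp only [hU, Matrix.mul_apply, Matrix.of_apply]
    rw [Finset.sum_comm]
    refine Finset.sum_eq_zero fun b' _ => ?_
    rw [← Finset.sum_mul, h4, zero_mul]
  rw [inner, hodgeStar_smul, hodgeStar_sum]
  simp only [hodgeStar_sum, hodgeStar_smul]
  simp only [hodgeStar, swap, Matrix.smul_apply, Matrix.sum_apply,
    dual_dual_of_traceless U u1 u2 u3, smul_eq_mul]
  have e : ∑ s, ∑ r, g ρ r * g s σ * (√g.det * U r s μ ν) =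
      √g.det * (g * (g⁻¹ * (Matrix.of fun a b => W a b μ ν) * g⁻¹) * g) ρ σ := by
    generalize hX : (fun a b c d => (g⁻¹ * (Matrix.of fun a b => W a b c d) * g⁻¹) a b) = X at hU
    have hX' : g⁻¹ * (Matrix.of fun a b => W a b μ ν) * g⁻¹ = Matrix.of fun a b => X a b μ ν := by
      rw [← hX]; rfl
    rw [hX', hU]
    simp only [Matrix.mul_apply, Finset.sum_mul, Finset.mul_sum, Matrix.of_apply]
    exact Finset.sum_congr rfl fun _ _ => Finset.sum_congr rfl fun _ _ => by ring
  rw [e, hg.lower_raise, Matrix.of_apply, ← mul_assoc, inv_mul_cancel₀ hg.sqrt_pos.ne', one_mul, h3]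

/-- With ⋆ written as a lowered dual, the inverse metric of the divergence cancels one factor g,
which leaves a metric-free contraction up to an invertible factor. The sign comes from the
antisymmetry of the dual. -/
theorem sum_inv_mul_hodgeStar {C : Fin 4 → Mat4} (hC : ∀ l, (C l)ᵀ = -C l) (ν : Fin 4) :
    ∑ μ, ∑ l, g⁻¹ μ l * hodgeStar g (C l) μ ν =
      -((√g.det)⁻¹ * ∑ κ, (∑ l, dual (C l) κ l) * g κ ν) := by
  have e : ∀ l, ∑ μ, g⁻¹ μ l * hodgeStar g (C l) μ ν =
      -((√g.det)⁻¹ * ∑ κ, dual (C l) κ l * g κ ν) := by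
    intro l
    have : ∑ μ, g⁻¹ μ l * hodgeStar g (C l) μ ν = (g⁻¹ * hodgeStar g (C l)) l ν := by
      rw [Matrix.mul_apply]
      exact Finset.sum_congr rfl fun _ _ => by rw [hg.inv_apply_comm]
    rw [this, hg.hodgeStar_eq_lower_dual (hC l), Matrix.mul_smul, Matrix.smul_apply, smul_eq_mul,
      Matrix.mul_assoc, ← Matrix.mul_assoc g⁻¹, hg.inv_mul, Matrix.one_mul, Matrix.mul_apply,
      ← mul_neg, ← Finset.sum_neg_distrib]
    congr 1
    refine Finset.sum_congr rfl fun κ _ => ?_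
    have := congrFun (congrFun (dual_antisymm (C l)) κ) l
    rw [Matrix.transpose_apply, Matrix.neg_apply] at this
    rw [this]; ring
  rw [Finset.sum_comm]
  simp only [e, Finset.sum_neg_distrib, Finset.mul_sum, Finset.sum_mul]
  rw [Finset.sum_comm]

/-- The divergence of the Hodge dual vanishes if and only if the cyclic sums do. -/
theorem sum_inv_mul_hodgeStar_eq_zero_iff {C : Fin 4 → Mat4} (hC : ∀ l, (C l)ᵀ = -C l) :
    (∀ ν, ∑ μ, ∑ l, g⁻¹ μ l * hodgeStar g (C l) μ ν = 0) ↔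
      ∀ l μ ν, C l μ ν + C μ ν l + C ν l μ = 0 := by
  rw [cyclic_sum_eq_zero_iff hC]
  constructor
  · intro h
    have h' : Matrix.vecMul (fun κ => ∑ l, dual (C l) κ l) g = 0 := by
      funext ν
      have := h ν
      rw [hg.sum_inv_mul_hodgeStar hC, neg_eq_zero, mul_eq_zero] at this
      exact this.resolve_left (inv_ne_zero hg.sqrt_pos.ne')
    have h2 := congrArg (fun v => Matrix.vecMul v g⁻¹) h'
    simp only [Matrix.vecMul_vecMul, hg.mul_inv, Matrix.vecMul_one, Matrix.zero_vecMul] at h2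
    exact fun κ => congrFun h2 κ
  · intro h ν
    rw [hg.sum_inv_mul_hodgeStar hC]
    simp [h]

end IsMetric

/-! ### Formal properties of the covariant derivative of 4-tensors. -/

section CovDeriv

variable {G : E4 → Mat4} {U : Set E4}

theorem covDeriv_congr (hU : IsOpen U) {T T' : E4 → Fin 4 → Fin 4 → Fin 4 → Fin 4 → ℝ} {x : E4}
    (hx : x ∈ U) (h : ∀ y ∈ U, ∀ a b c d, T y a b c d = T' y a b c d) (l μ ν ρ σ : Fin 4) :
    covDeriv G T x l μ ν ρ σ = covDeriv G T' x l μ ν ρ σ := by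
  simp only [covDeriv, h x hx]
  rw [pd_congr_of_isOpen hU hx (fun y hy => h y hy μ ν ρ σ)]

theorem covDeriv_linear {T T' : E4 → Fin 4 → Fin 4 → Fin 4 → Fin 4 → ℝ} {x : E4}
    (hT : ∀ a b c d, DifferentiableAt ℝ (fun y => T y a b c d) x)
    (hT' : ∀ a b c d, DifferentiableAt ℝ (fun y => T' y a b c d) x) (k k' : ℝ)
    (l μ ν ρ σ : Fin 4) :
    covDeriv G (fun y a b c d => k * T y a b c d + k' * T' y a b c d) x l μ ν ρ σ =
      k * covDeriv G T x l μ ν ρ σ + k' * covDeriv G T' x l μ ν ρ σ := by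
  simp only [covDeriv]
  rw [pd_add l ((hT _ _ _ _).const_mul k) ((hT' _ _ _ _).const_mul k'),
    pd_const_mul l k (hT _ _ _ _), pd_const_mul l k' (hT' _ _ _ _), mul_sub, mul_sub,
    Finset.mul_sum, Finset.mul_sum, sub_add_sub_comm, ← Finset.sum_add_distrib]
  congr 1
  exact Finset.sum_congr rfl fun κ _ => by ring

theorem covDeriv_antisymm_left (hU : IsOpen U) {T : E4 → Fin 4 → Fin 4 → Fin 4 → Fin 4 → ℝ}
    {x : E4} (hx : x ∈ U) (h : ∀ y ∈ U, ∀ a b c d, T y b a c d = -T y a b c d)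
    (l μ ν ρ σ : Fin 4) : covDeriv G T x l ν μ ρ σ = -covDeriv G T x l μ ν ρ σ := by
  simp only [covDeriv]
  rw [pd_congr_of_isOpen hU hx (fun y hy => h y hy μ ν ρ σ), pd_neg, neg_sub, ← sub_eq_zero]
  have : ∀ κ, christoffel G x κ l ν * T x κ μ ρ σ + christoffel G x κ l μ * T x ν κ ρ σ
      + christoffel G x κ l ρ * T x ν μ κ σ + christoffel G x κ l σ * T x ν μ ρ κ =
      -(christoffel G x κ l μ * T x κ ν ρ σ + christoffel G x κ l ν * T x μ κ ρ σ
      + christoffel G x κ l ρ * T x μ ν κ σ + christoffel G x κ l σ * T x μ ν ρ κ) := by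
    intro κ
    rw [h x hx μ κ, h x hx κ ν, h x hx μ ν, h x hx μ ν]; ring
  simp only [this, Finset.sum_neg_distrib]
  ring

theorem covDeriv_pair (hU : IsOpen U) {T : E4 → Fin 4 → Fin 4 → Fin 4 → Fin 4 → ℝ}
    {x : E4} (hx : x ∈ U) (h : ∀ y ∈ U, ∀ a b c d, T y a b c d = T y c d a b)
    (l μ ν ρ σ : Fin 4) : covDeriv G T x l μ ν ρ σ = covDeriv G T x l ρ σ μ ν := by
  simp only [covDeriv]
  rw [pd_congr_of_isOpen hU hx (fun y hy => h y hy μ ν ρ σ)]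
  congr 1
  refine Finset.sum_congr rfl fun κ _ => ?_
  rw [h x hx κ ν, h x hx μ κ, h x hx μ ν κ, h x hx μ ν ρ κ]; ring

end CovDeriv

namespace IsMetricOn

variable {G : E4 → Mat4} {U : Set E4} (hG : IsMetricOn G U)
include hG

/-- Since ∇g⁻¹ = 0, metric contraction commutes with ∇; the connection terms cancel by cyclicity of
the trace. -/
theorem pd_trace_inv_mul {x : E4} (hx : x ∈ U) {P : E4 → Mat4} (hP : EntryDiff x P) (l : Fin 4) :
    pd l (fun y => ((G y)⁻¹ * P y).trace) x = ((G x)⁻¹ * covD G l P x).trace := by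
  have dH := hG.smooth_inv.mdiff hG.isOpen hx
  have e : pd l (fun y => ((G y)⁻¹ * P y).trace) x = (pdM l (fun y => (G y)⁻¹ * P y) x).trace := by
    simp only [Matrix.trace, Matrix.diag_apply]
    rw [pd_sum _ _ fun i _ => dH.mul hP i i]
    rfl
  rw [e, EntryDiff.pdM_mul dH hP, hG.pdM_inv hx, covD]
  have c : ((G x)⁻¹ * (P x * Gam G l x)).trace = (Gam G l x * ((G x)⁻¹ * P x)).trace := by
    rw [← Matrix.mul_assoc, trace_mul_comm]
  simp only [sub_mul, mul_sub, neg_mul, trace_add, trace_sub, trace_neg, Matrix.mul_assoc, c]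
  ring

/-- The contraction of the first and third index commutes with the covariant derivative of a
tensor for which this contraction vanishes. -/
theorem trace_covDeriv_eq_zero {T : E4 → Fin 4 → Fin 4 → Fin 4 → Fin 4 → ℝ} {x : E4} (hx : x ∈ U)
    (hT : ∀ a b c d, DifferentiableAt ℝ (fun y => T y a b c d) x)
    (h : ∀ y ∈ U, ∀ σ ν, ∑ ρ, ∑ μ, (G y)⁻¹ ρ μ * T y μ σ ρ ν = 0) (l σ ν : Fin 4) :
    ∑ ρ, ∑ μ, (G x)⁻¹ ρ μ * covDeriv G T x l μ σ ρ ν = 0 := by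
  have h1 := hG.pd_trace_inv_mul hx (P := fun y => Matrix.of fun a b => T y a σ b ν)
    (fun i j => hT i σ j ν) l
  rw [pd_congr_of_isOpen hG.isOpen hx (h := fun _ => 0) (fun y hy => by
    rw [← h y hy σ ν]; simp only [Matrix.trace, Matrix.diag_apply, Matrix.mul_apply,
      Matrix.of_apply]), pd_const] at h1
  have e : ∀ ρ μ, (G x)⁻¹ ρ μ * covDeriv G T x l μ σ ρ ν =
      (G x)⁻¹ ρ μ * covD G l (fun y => Matrix.of fun a b => T y a σ b ν) x μ ρ
      - ∑ κ, (Gam G l x κ σ * ((G x)⁻¹ ρ μ * T x μ κ ρ ν)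
        + Gam G l x κ ν * ((G x)⁻¹ ρ μ * T x μ σ ρ κ)) := by
    intro ρ μ
    rw [covDeriv_eq_first_third, mul_sub, Finset.mul_sum]
    congr 1
    exact Finset.sum_congr rfl fun κ _ => by ring
  simp only [e, Finset.sum_sub_distrib]
  have h2 : ∑ ρ, ∑ μ, (G x)⁻¹ ρ μ * covD G l (fun y => Matrix.of fun a b => T y a σ b ν) x μ ρ
      = 0 := by
    rw [h1]; simp only [Matrix.trace, Matrix.diag_apply, Matrix.mul_apply]
  have h3 : ∀ f : Fin 4 → Fin 4 → Fin 4 → ℝ, ∑ ρ, ∑ μ, ∑ κ, f ρ μ κ = ∑ κ, ∑ ρ, ∑ μ, f ρ μ κ := by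
    intro f
    rw [Finset.sum_comm (s := Finset.univ) (t := Finset.univ)
      (f := fun κ ρ => ∑ μ, f ρ μ κ)]
    exact Finset.sum_congr rfl fun _ _ => Finset.sum_comm
  rw [h2, h3]
  simp only [Finset.sum_add_distrib, ← Finset.mul_sum, h x hx]
  simp

theorem entryDiff_hodgeStar {x : E4} (hx : x ∈ U) {B : E4 → Mat4} (hB : EntryDiff x B) :
    EntryDiff x fun y => hodgeStar (G y) (B y) := by
  have dH := hG.smooth_inv.mdiff hG.isOpen hx
  exact ((dH.mul hB).mul dH).dual.smul (hG.differentiableAt_sqrt_det hx)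

/-- The Hodge star of the first two indices commutes with the covariant derivative. -/
theorem covDeriv_hodgeStar {T : E4 → Fin 4 → Fin 4 → Fin 4 → Fin 4 → ℝ} {x : E4} (hx : x ∈ U)
    (hT : ∀ a b c d, DifferentiableAt ℝ (fun y => T y a b c d) x)
    (h : ∀ a b c d, T x b a c d = -T x a b c d) (l μ ν ρ σ : Fin 4) :
    covDeriv G (fun y a b c d => hodgeStar (G y) (Matrix.of fun i j => T y i j c d) a b) x l μ ν ρ σ
      = hodgeStar (G x) (Matrix.of fun a b => covDeriv G T x l a b ρ σ) μ ν := by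
  have e : (Matrix.of fun a b => covDeriv G T x l a b ρ σ) =
      covD G l (fun y => Matrix.of fun a b => T y a b ρ σ) x
        + ∑ κ, ((-Gam G l x κ ρ) • (Matrix.of fun a b => T x a b κ σ)
          + (-Gam G l x κ σ) • (Matrix.of fun a b => T x a b ρ κ)) := by
    ext a b
    rw [Matrix.of_apply, covDeriv_eq]
    simp only [Matrix.add_apply, Matrix.sum_apply, Matrix.smul_apply, smul_eq_mul,
      Matrix.of_apply, neg_mul, ← neg_add, Finset.sum_neg_distrib]
    ring
  have d := hG.covD_hodgeStar hx (B := fun y => Matrix.of fun a b => T y a b ρ σ)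
    (fun i j => hT i j ρ σ) (by ext i j; exact h i j ρ σ) l
  rw [e, hodgeStar_add, hodgeStar_sum, ← d, covDeriv_eq]
  simp only [hodgeStar_add, hodgeStar_smul, Matrix.add_apply, Matrix.sum_apply, Matrix.smul_apply,
    smul_eq_mul, neg_mul, ← neg_add, Finset.sum_neg_distrib]
  rfl

/-- On curvature-like tensors, the self-dual projections in both pairs agree. -/
theorem sdWeyl_eq {x : E4} (hx : x ∈ U) (μ ν ρ σ : Fin 4) :
    sdWeyl G x μ ν ρ σ = 1 / 2 * weyl G x μ ν ρ σ
      + 1 / 2 * hodgeStar (G x) (Matrix.of fun a b => weyl G x a b ρ σ) μ ν := by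
  have hx' := hG.metric x hx
  set W := weyl G x with hW
  have w1 := hG.weyl_antisymm_left hx
  have key := hx'.hodgeStar_hodgeStar_of_traceless w1 (weyl_antisymm_right G x)
    (hG.weyl_pair hx) (hG.weyl_trace hx)
  -- Apply the left star to ⋆_L ⋆_R W = W and use ⋆_L² = 1 to get ⋆_R W = ⋆_L W. The four terms of
  -- the double projection then pair up into ½(W + ⋆_L W).
  have key2 : hodgeStar (G x) (Matrix.of fun c d => W μ ν c d) ρ σ =
      hodgeStar (G x) (Matrix.of fun a b => W a b ρ σ) μ ν := by
    have a : (Matrix.of fun a b => hodgeStar (G x) (Matrix.of fun c d => W a b c d) ρ σ)ᵀ =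
        -(Matrix.of fun a b => hodgeStar (G x) (Matrix.of fun c d => W a b c d) ρ σ) := by
      ext i j
      have : (Matrix.of fun c d => W j i c d) = (-1 : ℝ) • (Matrix.of fun c d => W i j c d) := by
        ext c d; simpa using w1 i j c d
      simp only [Matrix.transpose_apply, Matrix.of_apply, this, hodgeStar_smul, Matrix.smul_apply,
        Matrix.neg_apply]
      simp
    have h := hx'.hodgeStar_hodgeStar a
    have h' : hodgeStar (G x) (Matrix.of fun a b => hodgeStar (G x)
        (Matrix.of fun c d => W a b c d) ρ σ) = Matrix.of fun a b => W a b ρ σ := by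
      ext i j; exact key i j ρ σ
    rw [h'] at h
    exact (congrFun (congrFun h μ) ν).symm
  have lin : (Matrix.of fun a b => 1 / 2 * (W a b ρ σ
      + hodgeStar (G x) (Matrix.of fun c d => W a b c d) ρ σ)) = (1 / 2 : ℝ) •
      ((Matrix.of fun a b => W a b ρ σ)
        + (Matrix.of fun a b => hodgeStar (G x) (Matrix.of fun c d => W a b c d) ρ σ)) := by
    ext a b; rfl
  rw [sdWeyl, hx'.sdProj_apply]
  simp only [hx'.sdProj_apply]
  rw [lin, hodgeStar_smul, hodgeStar_add, key2, Matrix.smul_apply, Matrix.add_apply, key]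
  simp only [smul_eq_mul]
  ring

/-! ### Einstein metrics. -/

section Einstein

variable {Λ : ℝ} (hE : ∀ y ∈ U, ∀ μ ν, ricci G y μ ν = Λ * G y μ ν)
include hE

/-- The scalar curvature is 4Λ, so the coefficient is -½·2Λ + 4Λ/6 = -Λ/3. -/
theorem weyl_eq_of_einstein {x : E4} (hx : x ∈ U) (ρ σ μ ν : Fin 4) :
    weyl G x ρ σ μ ν = riemann G x ρ σ μ ν
      + -(Λ / 3) * (G x ρ μ * G x σ ν - G x ρ ν * G x σ μ) := by
  have hx' := hG.metric x hx
  have hs : scalarCurv G x = 4 * Λ := by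
    have : ∀ σ, ∑ ν, (G x)⁻¹ σ ν * (Λ * G x σ ν) = Λ := fun σ => by
      have : ∑ ν, (G x)⁻¹ σ ν * (Λ * G x σ ν) = Λ * ((G x)⁻¹ * G x) σ σ := by
        rw [Matrix.mul_apply, Finset.mul_sum]
        exact Finset.sum_congr rfl fun ν _ => by rw [hG.apply_comm hx σ ν]; ring
      rw [this, hx'.inv_mul, Matrix.one_apply_eq, mul_one]
    simp only [scalarCurv, hE x hx, this]
    simp
  rw [weyl, hs]
  simp only [hE x hx]
  ring

omit hE in
theorem covDeriv_metric_mul {x : E4} (hx : x ∈ U) (l ρ σ μ ν : Fin 4) :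
    covDeriv G (fun y a b c d => G y a c * G y b d - G y a d * G y b c) x l ρ σ μ ν = 0 := by
  have dG := hG.smooth.mdiff hG.isOpen hx
  have e : ∀ i j, pd l (fun y => G y i j) x = ∑ κ, (Gam G l x κ i * G x κ j
      + G x i κ * Gam G l x κ j) := by
    intro i j
    have := congrFun (congrFun (hG.pdM_metric hx l) i) j
    rw [Matrix.add_apply, Matrix.mul_apply, Matrix.mul_apply, ← Finset.sum_add_distrib] at this
    exact this
  rw [covDeriv, pd_sub l ((dG _ _).fun_mul (dG _ _)) ((dG _ _).fun_mul (dG _ _)),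
    pd_mul l (dG _ _) (dG _ _), pd_mul l (dG _ _) (dG _ _), e, e, e, e, sub_eq_zero]
  simp only [Finset.sum_mul, Finset.mul_sum, ← Finset.sum_add_distrib, ← Finset.sum_sub_distrib]
  refine Finset.sum_congr rfl fun κ _ => ?_
  simp only [Gam, Matrix.of_apply]
  ring

/-- The difference of the two tensors is a constant times a parallel tensor quadratic in g. The
constancy of Λ enters here; it transfers the second Bianchi identity to W. -/
theorem covDeriv_weyl_of_einstein {x : E4} (hx : x ∈ U) (l ρ σ μ ν : Fin 4) :
    covDeriv G (weyl G) x l ρ σ μ ν = covDeriv G (riemann G) x l ρ σ μ ν := by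
  have dG := hG.smooth.mdiff hG.isOpen hx
  rw [covDeriv_congr hG.isOpen hx (T' := fun y a b c d => 1 * riemann G y a b c d
      + -(Λ / 3) * (G y a c * G y b d - G y a d * G y b c))
      (fun y hy a b c d => by rw [hG.weyl_eq_of_einstein hE hy, one_mul]),
    covDeriv_linear (T' := fun y a b c d => G y a c * G y b d - G y a d * G y b c)
      (fun a b c d => (hG.smooth_riemann a b c d).differentiableAt_of_isOpen hG.isOpen hx)
      (fun a b c d => ((dG _ _).mul (dG _ _)).sub ((dG _ _).mul (dG _ _))),
    hG.covDeriv_metric_mul hx, mul_zero, add_zero, one_mul]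

/-- The self-dual Weyl tensor of an Einstein metric is divergence-free. -/
theorem divSDWeyl_of_einstein {x : E4} (hx : x ∈ U) (ν ρ σ : Fin 4) :
    divSDWeyl G x ν ρ σ = 0 := by
  have hx' := hG.metric x hx
  have dW := fun a b c d => (hG.smooth_weyl a b c d).differentiableAt_of_isOpen hG.isOpen hx
  have pair := covDeriv_pair (G := G) hG.isOpen hx (fun y hy => hG.weyl_pair hy)
  have anti := covDeriv_antisymm_left (G := G) hG.isOpen hx (fun y hy => hG.weyl_antisymm_left hy)
  set N : Fin 4 → Mat4 := fun l => Matrix.of fun a b => covDeriv G (weyl G) x l a b ρ σ with hN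
  have hNa : ∀ l, (N l)ᵀ = -N l := by
    intro l; ext i j; exact anti l i j ρ σ
  have bianchi : ∀ ρ σ l μ ν, covDeriv G (weyl G) x l ρ σ μ ν + covDeriv G (weyl G) x μ ρ σ ν l
      + covDeriv G (weyl G) x ν ρ σ l μ = 0 := by
    intro ρ σ l μ ν
    simp only [hG.covDeriv_weyl_of_einstein hE hx]
    exact hG.covDeriv_riemann_cyclic hx ρ σ l μ ν
  have cyc : ∀ l μ ν, N l μ ν + N μ ν l + N ν l μ = 0 := by
    intro l μ ν
    simp only [hN, Matrix.of_apply]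
    rw [pair l, pair μ, pair ν]
    exact bianchi ρ σ l μ ν
  -- Contracted Bianchi identity: the divergence of W equals a difference of two traces of ∇W, and
  -- both vanish.
  have d1 : ∑ μ, ∑ l, (G x)⁻¹ μ l * N l μ ν = 0 := by
    have t := hG.trace_covDeriv_eq_zero hx dW (fun y hy => hG.weyl_trace hy)
    have right : ∀ l a b c d, covDeriv G (weyl G) x l a b d c = -covDeriv G (weyl G) x l a b c d :=
      fun l a b c d => by rw [pair, anti, pair l c d]
    have e : ∀ μ l, (G x)⁻¹ μ l * N l μ ν = (G x)⁻¹ l μ * covDeriv G (weyl G) x ρ μ ν l σ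
        - (G x)⁻¹ l μ * covDeriv G (weyl G) x σ μ ν l ρ := by
      intro μ l
      have b := bianchi μ ν l ρ σ
      rw [right ρ] at b
      rw [← mul_sub, hx'.inv_apply_comm]
      congr 1
      simp only [hN, Matrix.of_apply]
      linarith
    rw [Finset.sum_comm]
    simp only [e, Finset.sum_sub_distrib, t, sub_zero]
  have d2 := (hx'.sum_inv_mul_hodgeStar_eq_zero_iff hNa).2 cyc ν
  have e : ∀ l μ, covDeriv G (sdWeyl G) x l μ ν ρ σ =
      1 / 2 * N l μ ν + 1 / 2 * hodgeStar (G x) (N l) μ ν := by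
    intro l μ
    have dH : ∀ a b c d, DifferentiableAt ℝ
        (fun y => hodgeStar (G y) (Matrix.of fun i j => weyl G y i j c d) a b) x := fun a b c d =>
      hG.entryDiff_hodgeStar hx (B := fun y => Matrix.of fun i j => weyl G y i j c d)
        (fun i j => dW i j c d) a b
    rw [covDeriv_congr hG.isOpen hx (fun y hy => hG.sdWeyl_eq hy),
      covDeriv_linear (T' := fun y a b c d =>
        hodgeStar (G y) (Matrix.of fun i j => weyl G y i j c d) a b) dW dH,
      hG.covDeriv_hodgeStar hx dW (hG.weyl_antisymm_left hx)]
    rfl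
  simp only [divSDWeyl, divergence, e, mul_add, Finset.sum_add_distrib, mul_left_comm _ (1 / 2 : ℝ),
    ← Finset.mul_sum, d1, d2, mul_zero, add_zero]

end Einstein

end IsMetricOn

/-! ### Self-dual frames and their connection -/

theorem covDeriv_sum {G : E4 → Mat4} {ι : Type*} [Fintype ι]
    {T : ι → E4 → Fin 4 → Fin 4 → Fin 4 → Fin 4 → ℝ} {x : E4}
    (hT : ∀ i a b c d, DifferentiableAt ℝ (fun y => T i y a b c d) x) (l μ ν ρ σ : Fin 4) :
    covDeriv G (fun y a b c d => ∑ i, T i y a b c d) x l μ ν ρ σ =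
      ∑ i, covDeriv G (T i) x l μ ν ρ σ := by
  simp only [covDeriv, Finset.sum_sub_distrib]
  rw [pd_sum _ _ fun i _ => hT i _ _ _ _]
  congr 1
  rw [Finset.sum_comm]
  refine Finset.sum_congr rfl fun κ _ => ?_
  simp only [Finset.mul_sum, Finset.sum_add_distrib]

theorem covDeriv_mul_mul {G : E4 → Mat4} {f : E4 → ℝ} {B C : E4 → Mat4} {x : E4}
    (hf : DifferentiableAt ℝ f x) (hB : EntryDiff x B) (hC : EntryDiff x C) (l μ ν ρ σ : Fin 4) :
    covDeriv G (fun y a b c d => f y * B y a b * C y c d) x l μ ν ρ σ =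
      pd l f x * B x μ ν * C x ρ σ + f x * covD G l B x μ ν * C x ρ σ
        + f x * B x μ ν * covD G l C x ρ σ := by
  rw [covDeriv, pd_mul l (hf.fun_mul (hB _ _)) (hC _ _), pd_mul l hf (hB _ _)]
  simp only [covD, Matrix.sub_apply, Matrix.mul_apply, Matrix.transpose_apply, pdM, Gam,
    Matrix.of_apply, mul_sub, sub_mul, Finset.mul_sum, Finset.sum_mul, Finset.sum_add_distrib]
  have e1 : ∀ κ, f x * (christoffel G x κ l μ * B x κ ν) * C x ρ σ =
    christoffel G x κ l μ * (f x * B x κ ν * C x ρ σ) := fun κ => by ring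
  have e2 : ∀ κ, f x * (B x μ κ * christoffel G x κ l ν) * C x ρ σ =
    christoffel G x κ l ν * (f x * B x μ κ * C x ρ σ) := fun κ => by ring
  have e3 : ∀ κ, f x * B x μ ν * (christoffel G x κ l ρ * C x κ σ) =
    christoffel G x κ l ρ * (f x * B x μ ν * C x κ σ) := fun κ => by ring
  have e4 : ∀ κ, f x * B x μ ν * (C x ρ κ * christoffel G x κ l σ) =
    christoffel G x κ l σ * (f x * B x μ ν * C x ρ κ) := fun κ => by ring
  simp only [e1, e2, e3, e4]
  ring

theorem covD_sum_smul {G : E4 → Mat4} {ι : Type*} [Fintype ι] {f : ι → E4 → ℝ}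
    {B : ι → E4 → Mat4} {x : E4} (hf : ∀ i, DifferentiableAt ℝ (f i) x)
    (hB : ∀ i, EntryDiff x (B i)) (l : Fin 4) :
    covD G l (fun y => ∑ i, f i y • B i y) x =
      ∑ i, (pd l (f i) x • B i x + f i x • covD G l (B i) x) := by
  have e : pdM l (fun y => ∑ i, f i y • B i y) x =
      ∑ i, (pd l (f i) x • B i x + f i x • pdM l (B i) x) := by
    simp only [← fun i => (hB i).pdM_smul (hf i) l]
    ext a b
    simp only [pdM, Matrix.of_apply, Matrix.sum_apply]
    exact pd_sum _ _ fun i _ => (hB i).smul (hf i) a b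
  simp only [covD, e, Matrix.mul_sum, Finset.sum_mul, ← Finset.sum_sub_distrib]
  refine Finset.sum_congr rfl fun i _ => ?_
  simp only [Matrix.mul_smul, Matrix.smul_mul]
  module

theorem pair_eq_sum (g B C : Mat4) :
    pair g B C = ∑ a, ∑ b, -(g⁻¹ * B * g⁻¹) b a * C a b := by
  have : pair g B C = -((g⁻¹ * B * g⁻¹) * C).trace := by
    rw [pair, trace_mul_comm]; simp only [Matrix.mul_assoc]
  rw [this, Finset.sum_comm]
  generalize g⁻¹ * B * g⁻¹ = X
  simp only [Matrix.trace, Matrix.diag_apply, Matrix.mul_apply, neg_mul, Finset.sum_neg_distrib]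

namespace IsMetricOn

variable {G : E4 → Mat4} {V : Set E4} (hG : IsMetricOn G V)
include hG

theorem covD_antisymm {x : E4} (hx : x ∈ V) {B : E4 → Mat4} (hB : ∀ y ∈ V, (B y)ᵀ = -B y)
    (l : Fin 4) : (covD G l B x)ᵀ = -covD G l B x := by
  have e : (pdM l B x)ᵀ = -pdM l B x := by
    ext i j
    have := pd_congr_of_isOpen hG.isOpen hx (fun y hy => congrFun (congrFun (hB y hy) i) j) l
    exact this.trans (pd_neg l)
  simp only [covD, transpose_sub, transpose_mul, transpose_transpose, e, hB x hx]
  simp only [neg_mul, mul_neg]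
  abel

/-- The exterior derivative of a 2-form in terms of the Levi-Civita connection. -/
theorem extd_eq {x : E4} (hx : x ∈ V) {B : E4 → Mat4} (hB : (B x)ᵀ = -B x) (l μ ν : Fin 4) :
    extd B x l μ ν = covD G l B x μ ν + covD G μ B x ν l + covD G ν B x l μ := by
  have c : ∀ a b c, Gam G a x b c = Gam G c x b a := fun a b c => hG.christoffel_comm hx b a c
  have b : ∀ i j, B x j i = -B x i j := fun i j => congrFun (congrFun hB i) j
  have z : ∑ κ, ((Gam G l x κ μ * B x κ ν + B x μ κ * Gam G l x κ ν)
      + (Gam G μ x κ ν * B x κ l + B x ν κ * Gam G μ x κ l)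
      + (Gam G ν x κ l * B x κ μ + B x l κ * Gam G ν x κ μ)) = 0 := by
    refine Finset.sum_eq_zero fun κ _ => ?_
    rw [c l κ μ, c ν κ l, c ν κ μ, b κ ν, b κ l, b κ μ]; ring
  simp only [Finset.sum_add_distrib] at z
  simp only [extd, covD, Matrix.sub_apply, Matrix.mul_apply, Matrix.transpose_apply, pdM,
    Matrix.of_apply]
  linarith

theorem pd_pair {x : E4} (hx : x ∈ V) {B C : E4 → Mat4} (hB : EntryDiff x B) (hC : EntryDiff x C)
    (l : Fin 4) : pd l (fun y => pair (G y) (B y) (C y)) x =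
      pair (G x) (covD G l B x) (C x) + pair (G x) (B x) (covD G l C x) := by
  have dH := hG.smooth_inv.mdiff hG.isOpen hx
  have e : ∀ y, pair (G y) (B y) (C y) = -((G y)⁻¹ * (B y * (G y)⁻¹ * C y)).trace := fun y => by
    rw [pair, trace_mul_comm]
  have e2 : covD G l (fun y => B y * (G y)⁻¹ * C y) x =
      covD G l B x * (G x)⁻¹ * C x + B x * (G x)⁻¹ * covD G l C x := by
    rw [covD, EntryDiff.pdM_mul (hB.mul dH) hC, EntryDiff.pdM_mul hB dH, hG.pdM_inv hx, covD, covD]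
    noncomm_ring
  simp only [e]
  rw [pd_neg, hG.pd_trace_inv_mul hx ((hB.mul dH).mul hC), e2, mul_add, trace_add, pair, pair,
    trace_mul_comm (_ * _ * _), trace_mul_comm (_ * _ * _), neg_add]

theorem contDiffOn_pair {B C : E4 → Mat4} (hB : EntrySmooth V B) (hC : EntrySmooth V C) :
    ContDiffOn ℝ ∞ (fun y => pair (G y) (B y) (C y)) V := by
  simp only [pair, Matrix.trace, Matrix.diag_apply]
  exact (ContDiffOn.sum fun i _ =>
    (((hB.mul hG.smooth_inv).mul hC).mul hG.smooth_inv) i i).neg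

theorem smooth_covD {B : E4 → Mat4} (hB : EntrySmooth V B) (l : Fin 4) :
    EntrySmooth V (covD G l B) :=
  ((hB.pdM hG.isOpen l).sub ((hG.smooth_Gam l).transpose.mul hB)).sub (hB.mul (hG.smooth_Gam l))

end IsMetricOn

theorem sum_comm_two {α β γ δ : Type*} [Fintype α] [Fintype β] [Fintype γ] [Fintype δ]
    (f : α → β → γ → δ → ℝ) :
    ∑ a, ∑ b, ∑ c, ∑ d, f a b c d = ∑ c, ∑ d, ∑ a, ∑ b, f a b c d :=
  calc ∑ a, ∑ b, ∑ c, ∑ d, f a b c d = ∑ a, ∑ c, ∑ b, ∑ d, f a b c d :=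
        Finset.sum_congr rfl fun _ _ => Finset.sum_comm
    _ = ∑ c, ∑ a, ∑ b, ∑ d, f a b c d := Finset.sum_comm
    _ = ∑ c, ∑ a, ∑ d, ∑ b, f a b c d :=
        Finset.sum_congr rfl fun _ _ => Finset.sum_congr rfl fun _ _ => Finset.sum_comm
    _ = ∑ c, ∑ d, ∑ a, ∑ b, f a b c d := Finset.sum_congr rfl fun _ _ => Finset.sum_comm

/-- The algebra behind the uniqueness of the self-dual connection. -/
theorem IsSDBasis.eq_zero_of_cross_eq_zero {g : Mat4} {S : Fin 3 → Mat4} (hS : IsSDBasis g S)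
    {b : Fin 3 → Fin 4 → ℝ}
    (v : ∀ i, ∑ k, ∑ j, eps ![i, j, k] • ((S k * g⁻¹) *ᵥ b j) = 0) (j : Fin 3) : b j = 0 := by
  have q := hS.quaternion
  generalize hJ : (fun k => S k * g⁻¹) = J
  have hJ' : ∀ k, S k * g⁻¹ = J k := fun k => congrFun hJ k
  simp only [hJ'] at q v
  have q00 : J 0 * J 0 = -1 := by rw [q]; simp [eps_three]
  have q11 : J 1 * J 1 = -1 := by rw [q]; simp [eps_three]
  have q12 : J 1 * J 2 = J 0 := by
    rw [q]; simp [Fin.sum_univ_three, eps_three]; norm_num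
  have q02 : J 0 * J 2 = -J 1 := by
    rw [q]; simp [Fin.sum_univ_three, eps_three]; norm_num
  have v0 : J 2 *ᵥ b 1 = J 1 *ᵥ b 2 := by
    have := v 0
    simp [Fin.sum_univ_three, eps_three] at this
    norm_num at this
    exact (neg_add_eq_zero.1 this).symm
  have v1 : J 0 *ᵥ b 2 = J 2 *ᵥ b 0 := by
    have := v 1
    simp [Fin.sum_univ_three, eps_three] at this
    norm_num at this
    exact add_neg_eq_zero.1 this
  have v2 : J 1 *ᵥ b 0 = J 0 *ᵥ b 1 := by
    have := v 2
    simp [Fin.sum_univ_three, eps_three] at this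
    norm_num at this
    exact (neg_add_eq_zero.1 this).symm
  have m0 : J 0 *ᵥ b 1 = -b 2 := by
    rw [← q12, ← Matrix.mulVec_mulVec, v0, Matrix.mulVec_mulVec, q11, Matrix.neg_mulVec,
      Matrix.one_mulVec]
  have m1 : b 1 = J 2 *ᵥ b 0 := by
    rw [← v1, ← neg_neg (b 2), ← m0, Matrix.mulVec_neg, Matrix.mulVec_mulVec, q00,
      Matrix.neg_mulVec, Matrix.one_mulVec, neg_neg]
  -- Inserting b_1 = J_2 b_0 into J_1 b_0 = J_0 b_1 gives J_1 b_0 = J_0 J_2 b_0, which is -J_1 b_0.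
  have m2 : J 1 *ᵥ b 0 = -(J 1 *ᵥ b 0) := by
    conv_lhs => rw [v2, m1, Matrix.mulVec_mulVec, q02, Matrix.neg_mulVec]
  have m3 : J 1 *ᵥ b 0 = 0 := by
    funext i
    have := congrFun m2 i
    simp only [Pi.neg_apply, Pi.zero_apply] at this ⊢
    linarith
  have b0 : b 0 = 0 := by
    have := congrArg (fun w => J 1 *ᵥ w) m3
    simpa [Matrix.mulVec_mulVec, q11, Matrix.neg_mulVec] using this
  have b1 : b 1 = 0 := by rw [m1, b0, Matrix.mulVec_zero]
  have b2 : b 2 = 0 := by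
    rw [b1, Matrix.mulVec_zero] at m0
    exact neg_eq_zero.1 m0.symm
  fin_cases j <;> assumption

/-- The self-dual connection of a frame. -/
def sdConn (G : E4 → Mat4) (S : Fin 3 → E4 → Mat4) (j : Fin 3) (x : E4) (l : Fin 4) : ℝ :=
  -(1 / 8) * ∑ i, ∑ k, eps ![i, j, k] * pair (G x) (S k x) (covD G l (S i) x)

namespace IsSDFrame

variable {G : E4 → Mat4} {V : Set E4} {S : Fin 3 → E4 → Mat4}

theorem antisymm' (hS : IsSDFrame G V S) (i : Fin 3) {x : E4} (hx : x ∈ V) :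
    (S i x)ᵀ = -S i x := by
  ext μ ν; exact hS.antisymm i x hx μ ν

variable (hS : IsSDFrame G V S) (hG : IsMetricOn G V)
include hS hG

theorem isSDBasis {x : E4} (hx : x ∈ V) : IsSDBasis (G x) fun i => S i x where
  antisymm i := hS.antisymm' i hx
  selfDual i := by
    ext μ ν
    exact (congrFun (congrFun ((hG.metric x hx).hodge_eq_hodgeStar (S i x)) μ) ν).symm.trans
      (hS.selfDual i x hx μ ν)
  quaternion i j := hS.quaternion i j x hx

theorem entryDiff {x : E4} (hx : x ∈ V) (i : Fin 3) : EntryDiff x (S i) :=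
  EntrySmooth.mdiff (hS.smooth i) hG.isOpen hx

/-- The star is parallel, so ∇ preserves self-duality and ∇Σ^i can be expanded in the frame. -/
theorem hodgeStar_covD {x : E4} (hx : x ∈ V) (i : Fin 3) (l : Fin 4) :
    hodgeStar (G x) (covD G l (S i) x) = covD G l (S i) x := by
  rw [← hG.covD_hodgeStar hx (hS.entryDiff hG hx i) (hS.antisymm' i hx)]
  have e : ∀ y ∈ V, hodgeStar (G y) (S i y) = S i y := fun y hy => (hS.isSDBasis hG hy).selfDual i
  simp only [covD]
  rw [pdM_congr_of_isOpen hG.isOpen hx e, e x hx]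

/-- The covariant derivatives of the frame are given by the self-dual connection. -/
theorem covD_eq {x : E4} (hx : x ∈ V) (i : Fin 3) (l : Fin 4) :
    covD G l (S i) x = ∑ k, (-∑ j, eps ![i, j, k] * sdConn G S j x l) • S k x := by
  have hb := hS.isSDBasis hG hx
  have h := hb.eq_sum_of_selfDual (hG.metric x hx)
    (hG.covD_antisymm hx (fun y hy => hS.antisymm' i hy) l) (hS.hodgeStar_covD hG hx i l)
  -- Differentiate the constant pairing 4δ^{ki}.
  have anti : ∀ i k, pair (G x) (S k x) (covD G l (S i) x) =
      -pair (G x) (S i x) (covD G l (S k) x) := by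
    intro i k
    have h1 := hG.pd_pair hx (hS.entryDiff hG hx k) (hS.entryDiff hG hx i) l
    rw [pd_congr_of_isOpen hG.isOpen hx (fun y hy => (hS.isSDBasis hG hy).pair_eq
      (hG.metric y hy) k i), pd_const, pair_comm _ _ (S i x)] at h1
    linarith
  conv_lhs => rw [h]
  rw [Finset.smul_sum]
  refine Finset.sum_congr rfl fun k _ => ?_
  rw [smul_smul]
  congr 1
  have z : ∀ i, pair (G x) (S i x) (covD G l (S i) x) = 0 := fun i => by linarith [anti i i]
  have a1 := anti 0 1
  have a2 := anti 0 2
  have a3 := anti 1 2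
  -- The factor -1/8 in `sdConn` is forced: pairing ∇Σ^i = -ε^{ijk} A^j Σ^k with Σ^k contributes 4,
  -- and contracting two Levi-Civita symbols contributes 2.
  simp only [sdConn, Fin.sum_univ_three, eps_three]
  fin_cases i <;> fin_cases k <;> simp [z, a1, a2, a3] <;> ring

theorem contDiffOn_sdConn (j : Fin 3) (l : Fin 4) :
    ContDiffOn ℝ ∞ (fun y => sdConn G S j y l) V := by
  simp only [sdConn]
  exact contDiffOn_const.mul (ContDiffOn.sum fun i _ => ContDiffOn.sum fun k _ =>
    contDiffOn_const.mul (hG.contDiffOn_pair (hS.smooth k) (hG.smooth_covD (hS.smooth i) l)))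

-- The connection is torsion-free, so d^A is the cyclic sum of the derivative ∇ + A, which acts on
-- both the form indices and the internal index.
omit hS in
theorem _root_.Plebanski.IsMetricOn.extdCov_eq {x : E4} (hx : x ∈ V) (A : Fin 3 → E4 → Fin 4 → ℝ) {B : Fin 3 → E4 → Mat4}
    (hB : ∀ i, (B i x)ᵀ = -B i x) (i : Fin 3) (l μ ν : Fin 4) :
    extdCov A B i x l μ ν =
      (covD G l (B i) x + ∑ k, (∑ j, eps ![i, j, k] * A j x l) • B k x) μ ν
      + (covD G μ (B i) x + ∑ k, (∑ j, eps ![i, j, k] * A j x μ) • B k x) ν l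
      + (covD G ν (B i) x + ∑ k, (∑ j, eps ![i, j, k] * A j x ν) • B k x) l μ := by
  rw [extdCov, hG.extd_eq hx (hB i), Finset.sum_comm]
  simp only [wedge, Matrix.add_apply, Matrix.sum_apply, Matrix.smul_apply, smul_eq_mul,
    Finset.sum_mul, mul_add, Finset.sum_add_distrib, mul_assoc]
  ring

theorem isSDConnection_sdConn : IsSDConnection V S (sdConn G S) where
  smooth := hS.contDiffOn_sdConn hG
  compatible i x hx l μ ν := by
    have z : ∀ l, covD G l (S i) x + ∑ k, (∑ j, eps ![i, j, k] * sdConn G S j x l) • S k x = 0 := by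
      intro l
      rw [hS.covD_eq hG hx]
      simp only [neg_smul, Finset.sum_neg_distrib, neg_add_cancel]
    rw [hG.extdCov_eq hx _ (fun i => hS.antisymm' i hx), z, z, z]
    simp

/-- The self-dual connection of a frame is unique. -/
theorem eq_sdConn {A : Fin 3 → E4 → Fin 4 → ℝ} (hA : IsSDConnection V S A) {x : E4} (hx : x ∈ V)
    (j : Fin 3) (l : Fin 4) : A j x l = sdConn G S j x l := by
  have hb := hS.isSDBasis hG hx
  have hx' := hG.metric x hx
  set b : Fin 3 → Fin 4 → ℝ := fun j l => A j x l - sdConn G S j x l with hbdef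
  set C : Fin 3 → Fin 4 → Mat4 := fun i l => ∑ k, (∑ j, eps ![i, j, k] * b j l) • S k x with hC
  have hCa : ∀ i l, (C i l)ᵀ = -C i l := by
    intro i l
    simp only [hC, transpose_sum, transpose_smul, hS.antisymm' _ hx, smul_neg,
      Finset.sum_neg_distrib]
  have hCs : ∀ i l, hodgeStar (G x) (C i l) = C i l := by
    intro i l
    simp only [hC, hodgeStar_sum, hodgeStar_smul, hb.selfDual]
  have cyc : ∀ i l μ ν, C i l μ ν + C i μ ν l + C i ν l μ = 0 := by
    intro i l μ ν
    have h1 := hA.compatible i x hx l μ ν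
    have h2 := (hS.isSDConnection_sdConn hG).compatible i x hx l μ ν
    rw [extdCov, Finset.sum_comm] at h1 h2
    simp only [hC, hbdef, wedge, Matrix.sum_apply, Matrix.smul_apply, smul_eq_mul, Finset.sum_mul,
      mul_add, Finset.sum_add_distrib, mul_sub, sub_mul, Finset.sum_sub_distrib,
      mul_assoc] at h1 h2 ⊢
    linarith
  -- C is self-dual, so its vanishing cyclic sums amount to vanishing divergence; written with J_k =
  -- S_k g⁻¹ this is a quaternionic cross-product equation for b.
  have v : ∀ i, ∑ k, ∑ j, eps ![i, j, k] • ((S k x * (G x)⁻¹) *ᵥ b j) = 0 := by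
    intro i
    funext ν
    have h := (hx'.sum_inv_mul_hodgeStar_eq_zero_iff (hCa i)).2 (cyc i) ν
    simp only [hCs] at h
    have e : ∑ μ, ∑ l, (G x)⁻¹ μ l * C i l μ ν =
        -∑ k, ∑ j, eps ![i, j, k] * ((S k x * (G x)⁻¹) *ᵥ b j) ν := by
      have e1 : ∀ k j, ((S k x * (G x)⁻¹) *ᵥ b j) ν =
          -∑ μ, ∑ l, (G x)⁻¹ μ l * (b j l * S k x μ ν) := by
        intro k j
        simp only [Matrix.mulVec, dotProduct, Matrix.mul_apply, Finset.sum_mul]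
        rw [Finset.sum_comm, ← Finset.sum_neg_distrib]
        refine Finset.sum_congr rfl fun μ _ => ?_
        rw [← Finset.sum_neg_distrib]
        refine Finset.sum_congr rfl fun l _ => ?_
        rw [hS.antisymm k x hx μ ν]; ring
      simp only [e1, hC, Matrix.sum_apply, Matrix.smul_apply, smul_eq_mul, Finset.mul_sum,
        Finset.sum_mul, mul_neg, Finset.sum_neg_distrib, neg_neg]
      rw [sum_comm_two]
      exact Finset.sum_congr rfl fun _ _ => Finset.sum_congr rfl fun _ _ =>
        Finset.sum_congr rfl fun _ _ => Finset.sum_congr rfl fun _ _ => by ring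
    rw [e, neg_eq_zero] at h
    simpa [Finset.sum_apply] using h
  have : b j = 0 := hb.eq_zero_of_cross_eq_zero v j
  exact sub_eq_zero.1 (congrFun this l)

end IsSDFrame

/-! ### The matrix of the self-dual Weyl curvature -/

/-- The coefficients `(1/16) Σ^i_{μν} W^{μνρσ} Σ^j_{ρσ}`. -/
def weylMatrix (G : E4 → Mat4) (S : Fin 3 → E4 → Mat4) (x : E4) : Matrix (Fin 3) (Fin 3) ℝ :=
  Matrix.of fun i j => 1 / 16 * pair (G x) (S i x) (Matrix.of fun a b =>
    pair (G x) (S j x) (Matrix.of fun c d => weyl G x a b c d))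

namespace IsSDFrame

variable {G : E4 → Mat4} {V : Set E4} {S : Fin 3 → E4 → Mat4}
variable (hS : IsSDFrame G V S) (hG : IsMetricOn G V)
include hS hG

/-- The sum of Σ^i ⊗ Σ^i is a multiple of the self-dual projector, so the trace is a full
contraction of W with 1 + ⋆. The first part vanishes because W is trace-free (`e5`), the second is
an ε-contraction and vanishes by the first Bianchi identity (`e6`). -/
theorem weylMatrix_trace {x : E4} (hx : x ∈ V) : (weylMatrix G S x).trace = 0 := by
  have hb := hS.isSDBasis hG hx
  have hx' := hG.metric x hx
  set W := weyl G x with hW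
  have w1 : ∀ a b c d, W b a c d = -W a b c d := hG.weyl_antisymm_left hx
  have w2 : ∀ a b c d, W a b d c = -W a b c d := weyl_antisymm_right G x
  have w3 : ∀ a b c d, W a b c d + W a c d b + W a d b c = 0 := hG.weyl_cyclic hx
  have anti : ∀ c d, (Matrix.of fun a b => W a b c d)ᵀ = -(Matrix.of fun a b => W a b c d) := by
    intro c d; ext i j; exact w1 i j c d
  have e1 : ∀ i, pair (G x) (S i x) (Matrix.of fun a b =>
      pair (G x) (S i x) (Matrix.of fun c d => W a b c d)) = ∑ c, ∑ d,
      -((G x)⁻¹ * (pair (G x) (S i x) (Matrix.of fun a b => W a b c d) • S i x) * (G x)⁻¹) d c := by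
    intro i
    simp only [pair_eq_sum, Matrix.of_apply, Finset.mul_sum]
    rw [sum_comm_two]
    refine Finset.sum_congr rfl fun c _ => Finset.sum_congr rfl fun d _ => ?_
    simp only [Matrix.mul_smul, Matrix.smul_mul, Matrix.smul_apply, smul_eq_mul, Finset.sum_mul,
      ← Finset.sum_neg_distrib]
    exact Finset.sum_congr rfl fun _ _ => Finset.sum_congr rfl fun _ _ => by ring
  have e2 : ∀ c d, ∑ i, pair (G x) (S i x) (Matrix.of fun a b => W a b c d) • S i x =
      (2 : ℝ) • ((Matrix.of fun a b => W a b c d)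
        + hodgeStar (G x) (Matrix.of fun a b => W a b c d)) := by
    intro c d
    have h := hb.half_add_hodgeStar hx' (anti c d)
    have h2 : ∀ X : Mat4, (2 : ℝ) • X = (4 : ℝ) • (1 / 2 : ℝ) • X := fun X => by
      rw [smul_smul]; norm_num
    rw [h2, h, smul_smul]
    norm_num
  have e3 : ∑ i, pair (G x) (S i x) (Matrix.of fun a b =>
      pair (G x) (S i x) (Matrix.of fun c d => W a b c d)) = ∑ c, ∑ d,
      -((G x)⁻¹ * ((2 : ℝ) • ((Matrix.of fun a b => W a b c d)
        + hodgeStar (G x) (Matrix.of fun a b => W a b c d))) * (G x)⁻¹) d c := by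
    simp only [e1]
    rw [Finset.sum_comm]
    refine Finset.sum_congr rfl fun c _ => ?_
    rw [Finset.sum_comm]
    refine Finset.sum_congr rfl fun d _ => ?_
    rw [← e2, Finset.sum_neg_distrib, Matrix.mul_sum, Finset.sum_mul, Matrix.sum_apply]
  have e4 : ∀ c d, ((G x)⁻¹ * ((2 : ℝ) • ((Matrix.of fun a b => W a b c d)
        + hodgeStar (G x) (Matrix.of fun a b => W a b c d))) * (G x)⁻¹) d c =
      2 * ((G x)⁻¹ * (Matrix.of fun a b => W a b c d) * (G x)⁻¹) d c
        + 2 * ((√(G x).det)⁻¹ * dual (Matrix.of fun a b => W a b c d) d c) := by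
    intro c d
    rw [hx'.hodgeStar_eq_lower_dual (anti c d), Matrix.mul_smul, Matrix.smul_mul, mul_add, add_mul,
      Matrix.mul_smul, Matrix.smul_mul, hx'.raise_lower]
    simp only [Matrix.smul_apply, Matrix.add_apply, smul_eq_mul, mul_add]
  have e5 : ∑ c, ∑ d, ((G x)⁻¹ * (Matrix.of fun a b => W a b c d) * (G x)⁻¹) d c = 0 := by
    simp only [Matrix.mul_apply, Matrix.of_apply, Finset.sum_mul]
    refine Finset.sum_eq_zero fun c _ => ?_
    rw [Finset.sum_comm]
    refine Finset.sum_eq_zero fun b _ => ?_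
    have h := hG.weyl_trace hx b c
    have e : ∀ d a, (G x)⁻¹ d a * W a b c d * (G x)⁻¹ b c =
        -(G x)⁻¹ b c * ((G x)⁻¹ d a * weyl G x a b d c) := by
      intro d a
      rw [w2]; ring
    simp only [e, ← Finset.mul_sum, h, mul_zero]
  have e6 : ∑ c, ∑ d, dual (Matrix.of fun a b => W a b c d) d c = 0 := by
    simp only [dual_apply_of_antisymm (anti _ _), Fin.sum_univ_four]
    simp
    have w4 : ∀ a b c d, W a b c d = W c d a b := hG.weyl_pair hx
    linarith [w3 0 1 2 3, w2 0 1 2 3, w2 0 2 1 3, w2 0 3 1 2, w2 1 2 0 3, w2 1 3 0 2, w2 2 3 0 1,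
      w4 0 1 2 3, w4 0 2 1 3, w4 0 3 1 2]
  have e7 : (weylMatrix G S x).trace = 1 / 16 * ∑ i, pair (G x) (S i x) (Matrix.of fun a b =>
      pair (G x) (S i x) (Matrix.of fun c d => W a b c d)) := by
    simp only [weylMatrix, Matrix.trace, Matrix.diag_apply, Matrix.of_apply, Finset.mul_sum, hW]
  rw [e7, e3]
  simp only [e4, Finset.sum_neg_distrib, Finset.sum_add_distrib, ← Finset.mul_sum, e5, e6]
  simp

theorem isWeylMatrix_weylMatrix : IsWeylMatrix G V S (weylMatrix G S) where
  smooth i j := by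
    simp only [weylMatrix, Matrix.of_apply]
    exact contDiffOn_const.mul (hG.contDiffOn_pair (hS.smooth i) fun a b =>
      hG.contDiffOn_pair (hS.smooth j) fun c d => hG.smooth_weyl a b c d)
  symm x hx := by
    ext i j
    simp only [weylMatrix, Matrix.transpose_apply, Matrix.of_apply, pair_eq_sum, Finset.mul_sum]
    rw [sum_comm_two]
    refine Finset.sum_congr rfl fun a _ => Finset.sum_congr rfl fun b _ =>
      Finset.sum_congr rfl fun c _ => Finset.sum_congr rfl fun d _ => ?_
    rw [hG.weyl_pair hx]; ring
  traceless x hx := hS.weylMatrix_trace hG hx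
  weyl_eq x hx μ ν ρ σ := by
    have hb := hS.isSDBasis hG hx
    have hx' := hG.metric x hx
    have inner : ∀ a b, sdProj (G x) (fun κ l => weyl G x a b κ l) ρ σ = 1 / 4 * ∑ j,
        pair (G x) (S j x) (Matrix.of fun c d => weyl G x a b c d) * S j x ρ σ := fun a b =>
      hb.sdProj_eq hx' (weyl_antisymm_right G x a b) ρ σ
    rw [sdWeyl]
    simp only [inner]
    rw [hb.sdProj_eq hx']
    · have lin : ∀ i, pair (G x) (S i x) (Matrix.of fun a b => 1 / 4 * ∑ j,
          pair (G x) (S j x) (Matrix.of fun c d => weyl G x a b c d) * S j x ρ σ) =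
          ∑ j, 4 * weylMatrix G S x i j * S j x ρ σ := by
        intro i
        have e : (Matrix.of fun a b => 1 / 4 * ∑ j,
            pair (G x) (S j x) (Matrix.of fun c d => weyl G x a b c d) * S j x ρ σ) =
            ∑ j, (1 / 4 * S j x ρ σ) • (Matrix.of fun a b =>
              pair (G x) (S j x) (Matrix.of fun c d => weyl G x a b c d)) := by
          ext a b
          simp only [Matrix.of_apply, Matrix.sum_apply, Matrix.smul_apply, smul_eq_mul,
            Finset.mul_sum]
          exact Finset.sum_congr rfl fun _ _ => by ring
        rw [e, pair_sum_right]
        refine Finset.sum_congr rfl fun j _ => ?_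
        rw [pair_smul_right, weylMatrix, Matrix.of_apply]; ring
      simp only [lin]
      simp only [Finset.mul_sum, Finset.sum_mul]
      exact Finset.sum_congr rfl fun _ _ => Finset.sum_congr rfl fun _ _ => by ring
    · intro a b
      have : ∀ j, pair (G x) (S j x) (Matrix.of fun c d => weyl G x b a c d) =
          -pair (G x) (S j x) (Matrix.of fun c d => weyl G x a b c d) := by
        intro j
        have e : (Matrix.of fun c d => weyl G x b a c d) =
            (-1 : ℝ) • Matrix.of fun c d => weyl G x a b c d := by
          ext c d; simpa using hG.weyl_antisymm_left hx a b c d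
        rw [e, pair_smul_right]; ring
      simp only [this, neg_mul, Finset.sum_neg_distrib, mul_neg]

end IsSDFrame

/-- The covariant derivative `∂_l Ψ^{ij} + [A_l, Ψ]^{ij}` of the Weyl matrix, where `c` is the matrix
of `-A_l` in the adjoint representation. -/
def covPsi (Ψ : E4 → Matrix (Fin 3) (Fin 3) ℝ) (c : Fin 4 → Matrix (Fin 3) (Fin 3) ℝ) (x : E4)
    (l : Fin 4) (i j : Fin 3) : ℝ :=
  pd l (fun y => Ψ y i j) x + ∑ m, (c l m i * Ψ x m j + c l m j * Ψ x i m)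

theorem sum_covPsi_smul (c P : Matrix (Fin 3) (Fin 3) ℝ) (p : Fin 3 → ℝ) (S : Fin 3 → Mat4)
    (i : Fin 3) : ∑ j, (p j • S j + P i j • ∑ k, c j k • S k) + ∑ k, c k i • ∑ j, P k j • S j =
      ∑ j, (p j + ∑ m, (c m i * P m j + c m j * P i m)) • S j := by
  ext a b
  simp only [Fin.sum_univ_three, Matrix.add_apply, Matrix.smul_apply, smul_eq_mul]
  ring

namespace IsSDFrame

variable {G : E4 → Mat4} {V : Set E4} {S : Fin 3 → E4 → Mat4}
variable (hS : IsSDFrame G V S) (hG : IsMetricOn G V)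
include hS hG

/-- Leibniz rule: ∇ only rotates the frame among itself, and relabelling the sums moves this
rotation onto Ψ. -/
theorem covDeriv_sdWeyl {Ψ : E4 → Matrix (Fin 3) (Fin 3) ℝ} (hΨ : IsWeylMatrix G V S Ψ) {x : E4}
    (hx : x ∈ V) {c : Fin 4 → Matrix (Fin 3) (Fin 3) ℝ}
    (hc : ∀ l i, covD G l (S i) x = ∑ k, c l i k • S k x) (l μ ν ρ σ : Fin 4) :
    covDeriv G (sdWeyl G) x l μ ν ρ σ =
      ∑ i, ∑ j, covPsi Ψ c x l i j * S i x μ ν * S j x ρ σ := by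
  have dS := hS.entryDiff hG hx
  have dΨ : ∀ i j, DifferentiableAt ℝ (fun y => Ψ y i j) x := fun i j =>
    (hΨ.smooth i j).differentiableAt_of_isOpen hG.isOpen hx
  have d : ∀ i j a b c d, DifferentiableAt ℝ (fun y => Ψ y i j * S i y a b * S j y c d) x :=
    fun i j a b c d => ((dΨ i j).fun_mul (dS i a b)).fun_mul (dS j c d)
  rw [covDeriv_congr hG.isOpen hx hΨ.weyl_eq, covDeriv_sum
    (T := fun i y a b c d => ∑ j, Ψ y i j * S i y a b * S j y c d)
    (fun i a b c d' => DifferentiableAt.fun_sum fun j _ => d i j a b c d')]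
  have e : ∀ i, covDeriv G (fun y a b c d => ∑ j, Ψ y i j * S i y a b * S j y c d) x l μ ν ρ σ =
      ∑ j, (pd l (fun y => Ψ y i j) x * S i x μ ν * S j x ρ σ
        + Ψ x i j * (∑ k, c l i k * S k x μ ν) * S j x ρ σ
        + Ψ x i j * S i x μ ν * ∑ k, c l j k * S k x ρ σ) := by
    intro i
    rw [covDeriv_sum (T := fun j y a b c d => Ψ y i j * S i y a b * S j y c d) (d i)]
    refine Finset.sum_congr rfl fun j _ => ?_
    rw [covDeriv_mul_mul (dΨ i j) (dS i) (dS j), hc, hc]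
    simp only [Matrix.sum_apply, Matrix.smul_apply, smul_eq_mul]
  simp only [e]
  simp only [covPsi, Fin.sum_univ_three]
  ring

/-- Both conditions are statements about C^j_l = (D_lΨ)^{ij} Σ^i: one about its divergence, the
other about its cyclic sum. Self-duality of C makes them equivalent for each j, and independence of
the Σ^j separates the values of j. The equivalence is pointwise. -/
theorem divSDWeyl_eq_zero_iff {Ψ : E4 → Matrix (Fin 3) (Fin 3) ℝ} (hΨ : IsWeylMatrix G V S Ψ)
    {A : Fin 3 → E4 → Fin 4 → ℝ} (hA : IsSDConnection V S A) {x : E4} (hx : x ∈ V) :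
    (∀ ν ρ σ, divSDWeyl G x ν ρ σ = 0) ↔
      ∀ i l μ ν, extdCov A (psiSigma Ψ S) i x l μ ν = 0 := by
  have hb := hS.isSDBasis hG hx
  have hx' := hG.metric x hx
  have dS := hS.entryDiff hG hx
  have dΨ : ∀ i j, DifferentiableAt ℝ (fun y => Ψ y i j) x := fun i j =>
    (hΨ.smooth i j).differentiableAt_of_isOpen hG.isOpen hx
  set c : Fin 4 → Matrix (Fin 3) (Fin 3) ℝ :=
    fun l => Matrix.of fun i k => -∑ j, eps ![i, j, k] * A j x l with hcdef
  have hc : ∀ l i, covD G l (S i) x = ∑ k, c l i k • S k x := by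
    intro l i
    rw [hS.covD_eq hG hx]
    simp only [hcdef, Matrix.of_apply, hS.eq_sdConn hG hA hx]
  have hca : ∀ l i k, c l i k = -c l k i := by
    intro l i k
    simp only [hcdef, Matrix.of_apply, Fin.sum_univ_three, eps_three]
    ring
  -- The divergence contracts the first index of D_lΨ with the form being differentiated, d^A the
  -- second; symmetry of Ψ reconciles them.
  have symm : ∀ l i j, covPsi Ψ c x l i j = covPsi Ψ c x l j i := by
    intro l i j
    have s : ∀ y ∈ V, ∀ i j, Ψ y i j = Ψ y j i := fun y hy i j => (hΨ.symm y hy).apply j i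
    simp only [covPsi]
    rw [pd_congr_of_isOpen hG.isOpen hx (fun y hy => s y hy i j)]
    congr 1
    refine Finset.sum_congr rfl fun m _ => ?_
    rw [s x hx m j, s x hx i m]; ring
  set C : Fin 3 → Fin 4 → Mat4 := fun j l => ∑ i, covPsi Ψ c x l i j • S i x with hC
  have hCa : ∀ j l, (C j l)ᵀ = -C j l := by
    intro i l
    simp only [hC, transpose_sum, transpose_smul, hS.antisymm' _ hx, smul_neg,
      Finset.sum_neg_distrib]
  have hCs : ∀ j l, hodgeStar (G x) (C j l) = C j l := by
    intro i l
    simp only [hC, hodgeStar_sum, hodgeStar_smul, hb.selfDual]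
  have div : ∀ ν ρ σ, divSDWeyl G x ν ρ σ =
      ∑ j, (∑ μ, ∑ l, (G x)⁻¹ μ l * hodgeStar (G x) (C j l) μ ν) * S j x ρ σ := by
    intro ν ρ σ
    simp only [divSDWeyl, divergence, hS.covDeriv_sdWeyl hG hΨ hx hc, hCs]
    simp only [hC, Matrix.sum_apply, Matrix.smul_apply, smul_eq_mul, Finset.mul_sum, Finset.sum_mul]
    have : ∀ f : Fin 4 → Fin 4 → Fin 3 → Fin 3 → ℝ, ∑ μ, ∑ l, ∑ i, ∑ j, f μ l i j =
        ∑ j, ∑ μ, ∑ l, ∑ i, f μ l i j := by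
      intro f
      rw [sum_comm_two, Finset.sum_comm]
      refine Finset.sum_congr rfl fun j _ => ?_
      rw [Finset.sum_comm]
      exact Finset.sum_congr rfl fun μ _ => Finset.sum_comm
    rw [this]
    exact Finset.sum_congr rfl fun _ _ => Finset.sum_congr rfl fun _ _ =>
      Finset.sum_congr rfl fun _ _ => Finset.sum_congr rfl fun _ _ => by ring
  have ext' : ∀ i l μ ν, extdCov A (psiSigma Ψ S) i x l μ ν =
      C i l μ ν + C i μ ν l + C i ν l μ := by
    intro i l μ ν
    have pa : ∀ i, (psiSigma Ψ S i x)ᵀ = -psiSigma Ψ S i x := by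
      intro i
      simp only [psiSigma, transpose_sum, transpose_smul, hS.antisymm' _ hx, smul_neg,
        Finset.sum_neg_distrib]
    have e : ∀ l, covD G l (psiSigma Ψ S i) x
        + ∑ k, (∑ j, eps ![i, j, k] * A j x l) • psiSigma Ψ S k x = C i l := by
      intro l
      have h1 : covD G l (psiSigma Ψ S i) x = ∑ j, (pd l (fun y => Ψ y i j) x • S j x
          + Ψ x i j • covD G l (S j) x) := covD_sum_smul (fun j => dΨ i j) dS l
      have h2 : ∀ k, (∑ j, eps ![i, j, k] * A j x l) = c l k i := by
        intro k
        rw [hca l k i]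
        simp only [hcdef, Matrix.of_apply, neg_neg]
      rw [h1]
      simp only [hc, h2, psiSigma, hC]
      simp only [symm l _ i]
      exact sum_covPsi_smul (c l) (Ψ x) (fun j => pd l (fun y => Ψ y i j) x) (fun j => S j x) i
    rw [hG.extdCov_eq hx A pa, e, e, e]
  have step : ∀ j, (∀ ν, ∑ μ, ∑ l, (G x)⁻¹ μ l * hodgeStar (G x) (C j l) μ ν = 0) ↔
      ∀ l μ ν, extdCov A (psiSigma Ψ S) j x l μ ν = 0 := by
    intro j
    simp only [ext']
    exact hx'.sum_inv_mul_hodgeStar_eq_zero_iff (hCa j)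
  simp only [← step, div]
  constructor
  · intro h j ν
    refine hb.linearIndependent hx'
      (c := fun j => ∑ μ, ∑ l, (G x)⁻¹ μ l * hodgeStar (G x) (C j l) μ ν) ?_ j
    ext ρ σ
    simpa only [Matrix.sum_apply, Matrix.smul_apply, smul_eq_mul, Matrix.zero_apply] using h ν ρ σ
  · intro h ν ρ σ
    simp only [h, zero_mul, Finset.sum_const_zero]

end IsSDFrame

/-! ### The metric of a manifold in a chart -/

section Manifold

open Bundle

variable {M : Type*} [TopologicalSpace M] [ChartedSpace E4 M] [IsManifold 𝓘(ℝ, E4) ∞ M]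

/-- The field is the tangent map of φ⁻¹ composed with a constant section; with v a basis vector this
is smoothness of the coordinate fields. -/
theorem contMDiffOn_mfderiv_symm {φ : OpenPartialHomeomorph M E4}
    (hφ : φ ∈ IsManifold.maximalAtlas 𝓘(ℝ, E4) ∞ M) (v : E4) :
    ContMDiffOn 𝓘(ℝ, E4) (𝓘(ℝ, E4).prod 𝓘(ℝ, E4)) ∞
      (fun y => TotalSpace.mk' E4 (E := fun x : M => TangentSpace 𝓘(ℝ, E4) x) (φ.symm y)
        (mfderiv 𝓘(ℝ, E4) 𝓘(ℝ, E4) φ.symm y v)) φ.target := by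
  have : IsManifold 𝓘(ℝ, E4) 1 M := IsManifold.of_le (n := ∞) (by simp)
  have h1 : ContMDiffOn 𝓘(ℝ, E4) 𝓘(ℝ, E4) ∞ φ.symm φ.target :=
    contMDiffOn_symm_of_mem_maximalAtlas hφ
  have h2 := h1.contMDiffOn_tangentMapWithin (m := ∞) (by simp) φ.open_target.uniqueMDiffOn
  have h3 : ContMDiffOn 𝓘(ℝ, E4) (𝓘(ℝ, E4).prod 𝓘(ℝ, E4)) ∞
      (fun y : E4 => (⟨y, v⟩ : TangentBundle 𝓘(ℝ, E4) E4)) φ.target :=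
    contMDiffOn_vectorSpace_iff_contDiffOn.2 contDiffOn_const
  refine (h2.comp h3 (fun y hy => hy)).congr fun y hy => ?_
  simp only [Function.comp_apply, tangentMapWithin, mfderivWithin_of_isOpen φ.open_target hy]

theorem smooth_chartMetric (g : RiemMetric M) {φ : OpenPartialHomeomorph M E4}
    (hφ : φ ∈ IsManifold.maximalAtlas 𝓘(ℝ, E4) ∞ M) : EntrySmooth φ.target (chartMetric g φ) := by
  intro μ ν
  have h1 : ContMDiffOn 𝓘(ℝ, E4) 𝓘(ℝ, E4) ∞ φ.symm φ.target :=
    contMDiffOn_symm_of_mem_maximalAtlas hφ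
  have h2 := g.contMDiff.comp_contMDiffOn h1
  have h3 : ContMDiffOn 𝓘(ℝ, E4) (𝓘(ℝ, E4).prod 𝓘(ℝ, ℝ)) ∞
      (fun y => TotalSpace.mk' ℝ (E := Bundle.Trivial M ℝ) (φ.symm y)
        (chartMetric g φ y μ ν)) φ.target :=
    ContMDiffOn.clm_bundle_apply₂ (F₁ := E4) (F₂ := E4) h2
      (contMDiffOn_mfderiv_symm hφ _) (contMDiffOn_mfderiv_symm hφ _)
  intro y hy
  have h4 := h3 y hy
  simp only [contMDiffWithinAt_totalSpace] at h4
  exact contMDiffWithinAt_iff_contDiffWithinAt.1 h4.2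

theorem dotProduct_chartMetric_mulVec (g : RiemMetric M) (φ : OpenPartialHomeomorph M E4) (y : E4)
    (v : Fin 4 → ℝ) : v ⬝ᵥ (chartMetric g φ y *ᵥ v) = g.inner (φ.symm y)
      (mfderiv 𝓘(ℝ, E4) 𝓘(ℝ, E4) φ.symm y (WithLp.toLp 2 v : E4))
      (mfderiv 𝓘(ℝ, E4) 𝓘(ℝ, E4) φ.symm y (WithLp.toLp 2 v : E4)) := by
  have e : (WithLp.toLp 2 v : E4) = ∑ μ, v μ • EuclideanSpace.single μ (1 : ℝ) := by
    ext i
    simp [Finset.sum_apply, Pi.single_apply]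
  rw [e]
  generalize hL : mfderiv 𝓘(ℝ, E4) 𝓘(ℝ, E4) φ.symm y = L
  have e2 : L (∑ μ, v μ • EuclideanSpace.single μ (1 : ℝ) : E4) =
      ∑ μ, v μ • L (EuclideanSpace.single μ (1 : ℝ) : E4) := by
    exact (map_sum L _ _).trans (Finset.sum_congr rfl fun _ _ => map_smul L _ _)
  rw [e2]
  simp only [map_sum, map_smul, _root_.sum_apply, _root_.smul_apply,
    dotProduct, Matrix.mulVec, chartMetric, Matrix.of_apply, Finset.mul_sum, smul_eq_mul, hL]
  refine Finset.sum_congr rfl fun μ _ => ?_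
  refine Finset.sum_congr rfl fun ν _ => ?_
  rw [g.symm]
  ring

/-- The differential of φ⁻¹ is injective, so the component matrix inherits positive definiteness
from g and has positive determinant. -/
theorem isMetricOn_chartMetric (g : RiemMetric M) {φ : OpenPartialHomeomorph M E4}
    (hφ : φ ∈ IsManifold.maximalAtlas 𝓘(ℝ, E4) ∞ M) : IsMetricOn (chartMetric g φ) φ.target where
  isOpen := φ.open_target
  smooth := smooth_chartMetric g hφ
  metric y hy := by
    have symm : (chartMetric g φ y)ᵀ = chartMetric g φ y := by
      ext μ ν; exact g.symm _ _ _
    refine ⟨symm, Matrix.PosDef.det_pos ?_⟩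
    refine Matrix.PosDef.of_dotProduct_mulVec_pos (by
      rw [Matrix.IsHermitian, Matrix.conjTranspose_eq_transpose_of_trivial, symm]) fun v hv => ?_
    rw [star_trivial, dotProduct_chartMetric_mulVec]
    refine g.pos _ _ fun h => hv ?_
    have hd : φ.MDifferentiable 𝓘(ℝ, E4) 𝓘(ℝ, E4) :=
      ⟨(contMDiffOn_of_mem_maximalAtlas hφ).mdifferentiableOn (by simp),
        (contMDiffOn_symm_of_mem_maximalAtlas hφ).mdifferentiableOn (by simp)⟩
    have inj := hd.symm.mfderiv_injective (x := y) hy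
    have h0 : (WithLp.toLp 2 v : E4) = 0 := inj (h.trans (map_zero _).symm)
    exact congrArg WithLp.ofLp h0

end Manifold

end

end Plebanski

/-! ### The proposition on an oriented Riemannian four-manifold. -/

open Plebanski in
theorem mainTheorem4 {M : Type*} [TopologicalSpace M] [ChartedSpace E4 M]
    [IsManifold 𝓘(ℝ, E4) ∞ M] (g : RiemMetric M) (o : OrientedAtlas M) :
    (IsEinstein g → DivFreeSDWeyl g o) ∧
    ∀ φ ∈ o.charts, ∀ V : Set E4, IsOpen V → V ⊆ φ.target →
    ∀ S : Fin 3 → E4 → Matrix (Fin 4) (Fin 4) ℝ, IsSDFrame (chartMetric g φ) V S →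
      (∃ A Ψ, IsSDConnection V S A ∧ IsWeylMatrix (chartMetric g φ) V S Ψ) ∧
      ∀ A Ψ, IsSDConnection V S A → IsWeylMatrix (chartMetric g φ) V S Ψ →
        ((∀ y ∈ V, ∀ ν ρ σ, divSDWeyl (chartMetric g φ) y ν ρ σ = 0) ↔
          (∀ i, ∀ y ∈ V, ∀ l μ ν, extdCov A (psiSigma Ψ S) i y l μ ν = 0)) ∧
        (IsEinstein g →
          ∀ i, ∀ y ∈ V, ∀ l μ ν, extdCov A (psiSigma Ψ S) i y l μ ν = 0) := by
  have einstein : IsEinstein g → DivFreeSDWeyl g o := by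
    rintro ⟨Λ, hE⟩ φ hφ y hy ν ρ σ
    exact (isMetricOn_chartMetric g (o.smooth hφ)).divSDWeyl_of_einstein
      (hE φ (o.smooth hφ)) hy ν ρ σ
  refine ⟨einstein, fun φ hφ V hV hVφ S hS => ?_⟩
  have hG := (isMetricOn_chartMetric g (o.smooth hφ)).mono hV hVφ
  refine ⟨⟨_, _, hS.isSDConnection_sdConn hG, hS.isWeylMatrix_weylMatrix hG⟩,
    fun A Ψ hA hΨ => ?_⟩
  have key : (∀ y ∈ V, ∀ ν ρ σ, divSDWeyl (chartMetric g φ) y ν ρ σ = 0) ↔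
      ∀ i, ∀ y ∈ V, ∀ l μ ν, extdCov A (psiSigma Ψ S) i y l μ ν = 0 :=
    ⟨fun h i y hy => (hS.divSDWeyl_eq_zero_iff hG hΨ hA hy).1 (h y hy) i,
      fun h y hy => (hS.divSDWeyl_eq_zero_iff hG hΨ hA hy).2 fun i => h i y hy⟩
  exact ⟨key, fun hE => key.1 fun y hy => einstein hE φ hφ y (hVφ hy)⟩
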